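/- **Definitions.** A QAC circuit of depth $d$ on a finite set $Q$ of qubits is a product of unitaries $C = L_d M_d \cdots L_1 M_1 L_0$, where each $L_k$ is a tensor product of arbitrary single-qubit unitaries and each $M_k$ is a product of $\mathrm{CZ}$ gates with pairwise disjoint supports; the $\mathrm{CZ}$ gate with support $S \subseteq Q$ maps $|x\rangle$ to $-|x\rangle$ if $x_q = 1$ for all $q \in S$, and fixes $|x\rangle$ otherwise. A $(w,m)$-2D-QAC circuit (a 2D-QAC circuit of width $w$) is a QAC circuit whose qubits are arranged in a lattice with $w$ rows of length $m$, and in which the support of each $\mathrm{CZ}$ gate is an interval of consecutive qubits of one row or of one column. A 1D-QAC circuit on $m$ qubits is a $(1,m)$-2D-QAC circuit. The parity unitary $U_{\oplus_n}$ acts on $n+1$ qubits by $U_{\oplus_n}|x,b\rangle = |x,\, b \oplus x_1 \oplus \cdots \oplus x_n\rangle$ for $x \in \{0,1\}^n$, $b \in \{0,1\}$. A circuit $C$ synthesizes $U_{\oplus_n}$ if, for some placement of these $n+1$ qubits among the qubits of $C$, with the other $a$ qubits of $C$ as ancilla qubits, $C(|\phi\rangle \otimes |0^a\rangle) = (U_{\oplus_n}|\phi\rangle)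 \otimes |0^a\rangle$ for every $(n+1)$-qubit state $|\phi\rangle$. **Theorem.** 1. For every integer $n \ge 1$ there is a 1D-QAC circuit of depth $n$ on $n+1$ qubits (that is, with no ancilla qubits) that synthesizes $U_{\oplus_n}$. 2. There are functions $d(n) = O(\log n)$ and $m(n) = n^{O(1)}$ (as $n \to \infty$) such that for every $n \ge 1$ there is a $(2, m(n))$-2D-QAC circuit of depth $d(n)$ that synthesizes $U_{\oplus_n}$. 3. There are functions $d(n) = O\!\left(\frac{\log n}{\log\log n}\right)$, $w(n) = n^{O(1)}$ and $m(n) = n^{O(1)}$ (as $n \to \infty$) such that for every $n \ge 1$ there is a $(w(n), m(n))$-2D-QAC circuit of depth $d(n)$ that synthesizes $U_{\oplus_n}$. -/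

import Mathlib

namespace QAC

/-- Operators on the Hilbert space of the qubits `Q`, as matrices in the computational basis
`|x⟩`, where `x : Q → Bool`. -/
abbrev Operator (Q : Type) : Type := Matrix (Q → Bool) (Q → Bool) ℂ

/-- The tensor product over all qubits `q` of the single-qubit unitaries `u q`. -/
def tensorUnitary {Q : Type} [Fintype Q] (u : Q → Matrix.unitaryGroup Bool ℂ) : Operator Q :=
  Matrix.of fun x y => ∏ q, (u q : Matrix Bool Bool ℂ) (x q) (y q)

/-- The `CZ` gate with support `S`: it multiplies `|x⟩` by `-1` if all qubits of `S` are `1` in `x`,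
and fixes `|x⟩` otherwise. -/
def czGate {Q : Type} [DecidableEq Q] [Fintype Q] (S : Finset Q) : Operator Q :=
  Matrix.diagonal fun x => if ∀ q ∈ S, x q = true then -1 else 1

/-- One step `L M` of a circuit: a layer `M` of `CZ` gates with pairwise disjoint (nonempty)
supports, followed by a layer `L` of arbitrary single-qubit unitaries. -/
structure Layer (Q : Type) where
  gates : Finset (Finset Q)
  gates_nonempty : ∀ S ∈ gates, S.Nonempty
  gates_disjoint : ∀ S ∈ gates, ∀ T ∈ gates, S ≠ T → Disjoint S T
  single : Q → Matrix.unitaryGroup Bool ℂ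

/-- `CZ` gates are diagonal, so that they commute. -/
theorem czGate_commute {Q : Type} [DecidableEq Q] [Fintype Q] (S T : Finset Q) :
    Commute (czGate S) (czGate T) :=
  Matrix.commute_diagonal _ _

/-- The operator `L M` of a layer; `M` is the product of its `CZ` gates. -/
def Layer.operator {Q : Type} [DecidableEq Q] [Fintype Q] (l : Layer Q) : Operator Q :=
  tensorUnitary l.single *
    l.gates.noncommProd czGate (fun S _ T _ _ => czGate_commute S T)

/-- A QAC circuit `L_d M_d ⋯ L_1 M_1 L_0` on the qubits `Q`. The list `layers` is in order of
application: its head is `L_1 M_1`. -/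
structure Circuit (Q : Type) where
  initial : Q → Matrix.unitaryGroup Bool ℂ
  layers : List (Layer Q)

/-- The depth of a circuit is its number of layers of `CZ` gates. -/
def Circuit.depth {Q : Type} (C : Circuit Q) : ℕ := C.layers.length

/-- The operator `L_d M_d ⋯ L_1 M_1 L_0` implemented by a circuit. -/
def Circuit.operator {Q : Type} [DecidableEq Q] [Fintype Q] (C : Circuit Q) : Operator Q :=
  C.layers.foldl (fun A l => l.operator * A) (tensorUnitary C.initial)

/-- A set of qubits of the `w × m` lattice is a line interval if it consists of consecutive qubits
of one row, or of consecutive qubits of one column. -/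
def IsLineInterval {w m : ℕ} (S : Finset (Fin w × Fin m)) : Prop :=
  (∃ (i : Fin w) (a b : Fin m), S = {i} ×ˢ Finset.Icc a b) ∨
    (∃ (a b : Fin w) (j : Fin m), S = Finset.Icc a b ×ˢ {j})

/-- `(w, m)`-2D-QAC circuits: the qubits `(i, j)` form a lattice with `w` rows of length `m`, and
each `CZ` gate acts on an interval of a row or of a column. The number `w` is the width. -/
structure Circuit2D (w m : ℕ) extends Circuit (Fin w × Fin m) where
  isLocal : ∀ l ∈ layers, ∀ S ∈ l.gates, IsLineInterval S

/-- 1D-QAC circuits on `m` qubits: 2D-QAC circuits of width `1`. -/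
abbrev Circuit1D (m : ℕ) : Type := Circuit2D 1 m

/-- The vector `|φ⟩ ⊗ |0^a⟩` on the qubits `Q`, where the `i`-th qubit of `φ` is placed at `e i` and
the other qubits of `Q` are the ancilla qubits. -/
def withAncilla {Q : Type} [DecidableEq Q] [Fintype Q] {k : ℕ} (e : Fin k ↪ Q)
    (φ : (Fin k → Bool) → ℂ) : (Q → Bool) → ℂ :=
  fun z => if ∀ q, q ∉ Finset.univ.map e → z q = false then φ (z ∘ e) else 0

/-- With its `k` input qubits placed by `e`, the circuit `C` synthesizes `U` exactly and cleanly: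
`C (|φ⟩ ⊗ |0^a⟩) = (U |φ⟩) ⊗ |0^a⟩` for all `φ`. -/
def Circuit.SynthesizesAt {Q : Type} [DecidableEq Q] [Fintype Q] (C : Circuit Q) {k : ℕ}
    (e : Fin k ↪ Q) (U : Operator (Fin k)) : Prop :=
  ∀ φ : (Fin k → Bool) → ℂ,
    C.operator.mulVec (withAncilla e φ) = withAncilla e (U.mulVec φ)

/-- `C` synthesizes `U` exactly and cleanly, for some placement of the input qubits. -/
def Circuit.Synthesizes {Q : Type} [DecidableEq Q] [Fintype Q] (C : Circuit Q) {k : ℕ}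
    (U : Operator (Fin k)) : Prop :=
  ∃ e : Fin k ↪ Q, C.SynthesizesAt e U

/-- The unitary `U_f |x, b⟩ = |x, b ⊕ f x⟩` on `n + 1` qubits; the target `b` is the last one. -/
def functionUnitary {n : ℕ} (f : (Fin n → Bool) → Bool) : Operator (Fin (n + 1)) :=
  Matrix.of fun y z =>
    if y = Function.update z (Fin.last n) (xor (z (Fin.last n)) (f fun i => z i.castSucc))
    then 1 else 0

/-- The parity of `n` bits. -/
def parity {n : ℕ} (x : Fin n → Bool) : Bool :=
  decide (Odd (Finset.univ.filter fun i => x i = true).card)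

/-- The parity unitary `|x, b⟩ ↦ |x, b ⊕ x_1 ⊕ ⋯ ⊕ x_n⟩`. -/
def parityUnitary (n : ℕ) : Operator (Fin (n + 1)) := functionUnitary parity

end QAC

set_option linter.unusedSectionVars false
set_option linter.unnecessarySeqFocus false

/-! All operators are tracked by their action on basis vectors, which determines them by linearity.
Single-qubit unitaries are free in depth: with Hadamard gates around the target, phase kickback
turns a `CZ` gate into a Toffoli gate (`kickback`, `Implements.toffoli`), and with `X` gates around
a qubit, a gate tests for zero instead of one. Every computation is undone after use, so all
ancillas return to zero.

On a line, the target sits in the middle. The outermost bits of both arms are added to their inner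
neighbours in one layer, the shorter arms are summed into the target, and the outer layer is
repeated to restore the bits. Such a round costs two layers and gains two inputs, which gives depth
exactly `n` (`IsArms.implemented`).

The other two constructions are trees (`exists_tree`). One level adds, in each block of `k + 1`
bits, the last `k` to the first; the first bits are treated recursively, and the level is repeated
to undo it. For `k = 1` a level is a layer of `CNOT` gates on disjoint intervals. For depth `log n /
log log n` one takes `k` of order `√(log n)` and needs constant depth for the parity of `k` bits, at
the price of `k ^ O(k)`, hence polynomially many, ancillas.

This gadget (`exists_gadget`) has a register of `N = (8 k) ^ k` columns of `k` qubits and one extra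
qubit. Marked states are the zero state and the states with an odd number of all-one columns. A
product of column reflections gives each kind weight exactly `1 / 8`; one round of amplitude
amplification then leaves only marked states, with weight `1 / 2` for each kind. A layer with one
gate per input `i`, testing that the input is set and that row `i` is zero, multiplies the zero
state by the sign of the parity and fixes the rest, since an all-one column makes every row nonzero.
The amplified state is thus fixed or sent to an orthogonal state, and undoing the preparation makes
the difference visible to one reflection.

For locality, the qubits are put in row `0` and all other lattice qubits are set to one, which makes
them invisible to `CZ` gates. A layer is simulated by copying qubits up their columns, applying each
gate in its own stretch of a row, and erasing the copies (`exists_latticePhase`). -/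

namespace QAC

open Matrix

/-! ### Operators on basis states, circuits with constrained layers, phase kickback -/

section Framework

/-- The computational basis vector `|z⟩`. -/
abbrev ket {α : Type} [DecidableEq α] (z : α) : α → ℂ := Pi.single z 1

theorem ket_apply {α : Type} [DecidableEq α] (z x : α) : ket z x = if x = z then 1 else 0 :=
  Pi.single_apply z 1 x

/-- The linear map with `|x⟩ ↦ |f x⟩`, as a matrix. -/
def basisMap {α β : Type} [DecidableEq β] (f : α → β) : Matrix β α ℂ :=
  Matrix.of fun y x => if y = f x then 1 else 0

theorem basisMap_mulVec_ket {α β : Type} [Fintype α] [DecidableEq α] [DecidableEq β] (f : α → β)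
    (z : α) : basisMap f *ᵥ ket z = ket (f z) := by
  ext y
  simp [basisMap, Pi.single_apply]

theorem basisMap_mulVec_apply {α β : Type} [Fintype α] [DecidableEq α] [DecidableEq β]
    {f : α → β} (hf : Function.Injective f) (φ : α → ℂ) (z : α) :
    (basisMap f *ᵥ φ) (f z) = φ z := by
  simp [basisMap, mulVec, dotProduct, hf.eq_iff]

theorem basisMap_mulVec_apply_of_notMem {α β : Type} [Fintype α] [DecidableEq β]
    {f : α → β} (φ : α → ℂ) {y : β} (hy : ∀ z, y ≠ f z) : (basisMap f *ᵥ φ) y = 0 := by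
  simp [basisMap, mulVec, dotProduct, hy]

theorem mulVec_eq_sum_ket {α β : Type} [Fintype α] [DecidableEq α] (A : Matrix β α ℂ)
    (φ : α → ℂ) : A *ᵥ φ = ∑ w, φ w • (A *ᵥ ket w) := by
  ext y
  simp [mulVec, dotProduct, mul_comm]

/-- The operator `A` acts on the vectors `|f x⟩` as `B` acts on the vectors `|x⟩`. -/
def Intertwines {α β : Type} [Fintype α] [Fintype β] [DecidableEq β] (f : α → β)
    (A : Matrix β β ℂ) (B : Matrix α α ℂ) : Prop :=
  A * basisMap f = basisMap f * B

namespace Intertwines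

variable {α β : Type} [Fintype α] [DecidableEq α] [Fintype β] [DecidableEq β] {f : α → β}
  {A A' : Matrix β β ℂ} {B B' : Matrix α α ℂ}

theorem of_ket (h : ∀ z, A *ᵥ ket (f z) = basisMap f *ᵥ (B *ᵥ ket z)) : Intertwines f A B := by
  refine Matrix.ext_of_mulVec_single fun z => ?_
  rw [← mulVec_mulVec, ← mulVec_mulVec, basisMap_mulVec_ket, h]

theorem mulVec (h : Intertwines f A B) (φ : α → ℂ) :
    A *ᵥ (basisMap f *ᵥ φ) = basisMap f *ᵥ (B *ᵥ φ) := by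
  rw [mulVec_mulVec, h, mulVec_mulVec]

theorem mul (h : Intertwines f A B) (h' : Intertwines f A' B') :
    Intertwines f (A * A') (B * B') := by
  rw [Intertwines, Matrix.mul_assoc, h', ← Matrix.mul_assoc, h, Matrix.mul_assoc]

end Intertwines

theorem diagonal_mulVec_ket {α : Type} [Fintype α] [DecidableEq α] (d : α → ℂ) (z : α) :
    diagonal d *ᵥ ket z = d z • ket z := by
  ext y
  by_cases h : y = z
  · subst h; simp [mulVec_diagonal]
  · simp [h]

variable {Q : Type} [Fintype Q] [DecidableEq Q]

/-- The sign by which the product of the `CZ` gates in `𝒢` multiplies `|x⟩`. -/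
def gatePhase (𝒢 : Finset (Finset Q)) (x : Q → Bool) : ℂ :=
  ∏ S ∈ 𝒢, if ∀ q ∈ S, x q = true then -1 else 1

theorem Layer.operator_eq (l : Layer Q) :
    l.operator = tensorUnitary l.single * diagonal (gatePhase l.gates) := by
  have key : ∀ (𝒢 : Finset (Finset Q)) (h : (𝒢 : Set (Finset Q)).Pairwise
      (Function.onFun Commute czGate)),
      𝒢.noncommProd czGate h = diagonal (gatePhase 𝒢) := by
    intro 𝒢
    induction 𝒢 using Finset.induction_on with
    | empty => intro h; simp [gatePhase, ← diagonal_one]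
    | insert S 𝒢 hS ih =>
      intro h
      rw [Finset.noncommProd_insert_of_notMem _ _ _ _ hS, ih, czGate, diagonal_mul_diagonal]
      congr 1
      ext x
      simp only [gatePhase]
      rw [Finset.prod_insert hS]
  exact congrArg _ (key _ _)

theorem tensorUnitary_mul (u v : Q → unitaryGroup Bool ℂ) :
    tensorUnitary u * tensorUnitary v = tensorUnitary (u * v) := by
  ext x y
  simp only [tensorUnitary, mul_apply, of_apply, Pi.mul_apply, Submonoid.coe_mul,
    ← Finset.prod_mul_distrib]
  rw [Finset.prod_univ_sum, Fintype.piFinset_univ]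

theorem tensorUnitary_one : tensorUnitary (1 : Q → unitaryGroup Bool ℂ) = 1 := by
  ext x y
  simp only [tensorUnitary, of_apply, Pi.one_apply, OneMemClass.coe_one, one_apply,
    Finset.prod_ite_zero, Finset.prod_const_one, Finset.mem_univ, true_imp_iff, funext_iff]

theorem tensorUnitary_star (u : Q → unitaryGroup Bool ℂ) :
    (tensorUnitary u)ᴴ = tensorUnitary (star u) := by
  ext x y
  simp [tensorUnitary]

theorem tensorUnitary_mem_unitaryGroup (u : Q → unitaryGroup Bool ℂ) :
    tensorUnitary u ∈ unitaryGroup (Q → Bool) ℂ := by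
  rw [mem_unitaryGroup_iff, star_eq_conjTranspose, tensorUnitary_star, tensorUnitary_mul,
    show u * star u = 1 from funext fun q => Unitary.mul_star_self (u q), tensorUnitary_one]

theorem tensorUnitary_mulVec_ket (u : Q → unitaryGroup Bool ℂ) (z x : Q → Bool) :
    (tensorUnitary u *ᵥ ket z) x = ∏ q, (u q : Matrix Bool Bool ℂ) (x q) (z q) := by
  simp [tensorUnitary]

/-- `𝒢` is a layer of `CZ` gates: the supports are nonempty and pairwise disjoint. -/
def IsGateLayer (𝒢 : Finset (Finset Q)) : Prop :=
  (∀ S ∈ 𝒢, S.Nonempty) ∧ ∀ S ∈ 𝒢, ∀ T ∈ 𝒢, S ≠ T → Disjoint S T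

/-- `Implements P d A`: the operator `A` is implemented by a circuit of depth `d` in which the
gate set of every layer satisfies `P`. -/
inductive Implements (P : Finset (Finset Q) → Prop) : ℕ → Operator Q → Prop
  | tensor (u : Q → unitaryGroup Bool ℂ) : Implements P 0 (tensorUnitary u)
  | layer {d : ℕ} {A : Operator Q} (u : Q → unitaryGroup Bool ℂ) (𝒢 : Finset (Finset Q))
      (h𝒢 : IsGateLayer 𝒢) (hP : P 𝒢) (h : Implements P d A) :
      Implements P (d + 1) (tensorUnitary u * diagonal (gatePhase 𝒢) * A)

namespace Implements

variable {P : Finset (Finset Q) → Prop} {d e : ℕ} {A B : Operator Q}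

theorem exists_circuit (h : Implements P d A) :
    ∃ C : Circuit Q, (∀ l ∈ C.layers, P l.gates) ∧ C.depth = d ∧ C.operator = A := by
  induction h with
  | tensor u => exact ⟨⟨u, []⟩, by simp, rfl, rfl⟩
  | layer u 𝒢 h𝒢 hP _ ih =>
    obtain ⟨C, hC, hd, hA⟩ := ih
    let l : Layer Q := ⟨𝒢, h𝒢.1, h𝒢.2, u⟩
    refine ⟨⟨C.initial, C.layers ++ [l]⟩, ?_, ?_, ?_⟩
    · intro l' hl'
      rcases List.mem_append.1 hl' with h | h
      · exact hC l' h
      · rw [List.mem_singleton.1 h]; exact hP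
    · simpa [Circuit.depth] using hd
    · simp only [Circuit.operator] at hA
      simp only [Circuit.operator, List.foldl_append, List.foldl_cons, List.foldl_nil, hA]
      rw [Layer.operator_eq]

/-- The new unitaries merge with the last single-qubit layer. This is why conjugation by Hadamard or
`X` gates never adds depth. -/
theorem tensor_mul (h : Implements P d A) (u : Q → unitaryGroup Bool ℂ) :
    Implements P d (tensorUnitary u * A) := by
  cases h with
  | tensor v => rw [tensorUnitary_mul]; exact .tensor _
  | layer v 𝒢 h𝒢 hP h =>
    rw [← Matrix.mul_assoc, ← Matrix.mul_assoc, tensorUnitary_mul]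
    exact .layer _ 𝒢 h𝒢 hP h

theorem mul (hB : Implements P e B) (hA : Implements P d A) : Implements P (d + e) (B * A) := by
  induction hB with
  | tensor u => exact hA.tensor_mul u
  | layer u 𝒢 h𝒢 hP _ ih => rw [Matrix.mul_assoc]; exact .layer u 𝒢 h𝒢 hP ih

theorem one : Implements P 0 (1 : Operator Q) := by
  rw [← tensorUnitary_one]; exact .tensor _

theorem phase {𝒢 : Finset (Finset Q)} (h𝒢 : IsGateLayer 𝒢) (hP : P 𝒢) :
    Implements P 1 (diagonal (gatePhase 𝒢)) := by
  have := Implements.layer 1 𝒢 h𝒢 hP one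
  rwa [tensorUnitary_one, Matrix.one_mul, Matrix.mul_one] at this

theorem congr_depth (h : Implements P d A) (hd : d = e) : Implements P e A := hd ▸ h

end Implements

/-- The Hadamard gate. -/
noncomputable def hadamard : unitaryGroup Bool ℂ :=
  ⟨Matrix.of fun x y => if x && y then -((Real.sqrt 2 : ℝ) : ℂ)⁻¹ else ((Real.sqrt 2 : ℝ) : ℂ)⁻¹, by
    have h : (((Real.sqrt 2 : ℝ) : ℂ))⁻¹ * ((Real.sqrt 2 : ℝ) : ℂ)⁻¹ = 1 / 2 := by
      rw [← mul_inv, ← Complex.ofReal_mul, Real.mul_self_sqrt (by norm_num)]; norm_num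
    rw [mem_unitaryGroup_iff]
    ext x y
    cases x <;> cases y <;> simp [mul_apply, star_eq_conjTranspose, h] <;> norm_num⟩

/-- The gate `X ^ c`. -/
def flipGate (c : Bool) : unitaryGroup Bool ℂ :=
  ⟨Matrix.of fun x y => if x = xor y c then 1 else 0, by
    rw [mem_unitaryGroup_iff]
    ext x y
    cases x <;> cases y <;> cases c <;> simp [mul_apply, star_eq_conjTranspose]⟩

/-- The gate `Z ^ c`. -/
def signGate (c : Bool) : unitaryGroup Bool ℂ :=
  ⟨diagonal fun x => if c && x then -1 else 1, by
    rw [mem_unitaryGroup_iff]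
    ext x y
    cases x <;> cases y <;> cases c <;> simp [mul_apply, star_eq_conjTranspose]⟩

theorem hadamard_mul_signGate_mul_hadamard (c : Bool) :
    hadamard * signGate c * hadamard = flipGate c := by
  have h : (((Real.sqrt 2 : ℝ) : ℂ))⁻¹ * ((Real.sqrt 2 : ℝ) : ℂ)⁻¹ = 1 / 2 := by
    rw [← mul_inv, ← Complex.ofReal_mul, Real.mul_self_sqrt (by norm_num)]; norm_num
  ext x y
  cases x <;> cases y <;> cases c <;>
    simp [hadamard, signGate, flipGate, mul_apply, diagonal_apply, h] <;> norm_num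

theorem flipGate_false : flipGate false = 1 := by
  ext x y; simp [flipGate, one_apply]

theorem signGate_false : signGate false = 1 := by
  ext x y; simp [signGate]

/-- The Hadamard gate on the qubits with `t q`. -/
noncomputable def hadamardOn (t : Q → Bool) : Operator Q :=
  tensorUnitary fun q => if t q then hadamard else 1

/-- The `X` gate on the qubits with `t q`. -/
def flipOn (t : Q → Bool) : Operator Q := tensorUnitary fun q => flipGate (t q)

theorem flipOn_mulVec_ket (t z : Q → Bool) : flipOn t *ᵥ ket z = ket fun q => xor (z q) (t q) := by
  ext x
  simp only [flipOn, tensorUnitary_mulVec_ket, flipGate, of_apply, Finset.prod_ite_zero,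
    Finset.prod_const_one, Finset.mem_univ, true_imp_iff, Pi.single_apply, funext_iff]

theorem flipOn_conj_diagonal (t : Q → Bool) (φ : (Q → Bool) → ℂ) :
    flipOn t * diagonal φ * flipOn t = diagonal fun x => φ fun q => xor (x q) (t q) := by
  refine Matrix.ext_of_mulVec_single fun z => ?_
  rw [← mulVec_mulVec, flipOn_mulVec_ket, ← mulVec_mulVec, diagonal_mulVec_ket, mulVec_smul,
    flipOn_mulVec_ket, diagonal_mulVec_ket]
  simp

/-- Conjugation by `X` gates lets a `CZ` gate test for zeros on the qubits with `t q`, still in one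
layer. -/
theorem Implements.flip_phase {P : Finset (Finset Q) → Prop} {𝒢 : Finset (Finset Q)}
    (h𝒢 : IsGateLayer 𝒢) (hP : P 𝒢) (t : Q → Bool) :
    Implements P 1 (diagonal fun x => gatePhase 𝒢 fun q => xor (x q) (t q)) := by
  rw [← flipOn_conj_diagonal, Matrix.mul_assoc]
  exact (((Implements.phase h𝒢 hP).mul (.tensor _)).tensor_mul _).congr_depth (by simp)

/-- Phase kickback: if `Φ` multiplies each `|w⟩` by the signs `(-1) ^ (c q * w q)`, then conjugation
by Hadamard gates turns it into flips by `c`. -/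
theorem kickback (t c z : Q → Bool) (hc : ∀ q, c q = true → t q = true) (Φ : Operator Q)
    (hΦ : ∀ w : Q → Bool, (∀ q, t q = false → w q = z q) →
      Φ *ᵥ ket w = (∏ q, if c q && w q then (-1 : ℂ) else 1) • ket w) :
    (hadamardOn t * Φ * hadamardOn t) *ᵥ ket z = ket fun q => xor (z q) (c q) := by
  -- The Hadamard gates spread `|z⟩` only over the `w` that agree with `z` off `t`. On those `Φ`
  -- acts as the product of the gates `Z ^ c q`; all other coefficients vanish.
  have h1 : Φ *ᵥ (hadamardOn t *ᵥ ket z) =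
      tensorUnitary (fun q => signGate (c q)) *ᵥ (hadamardOn t *ᵥ ket z) := by
    rw [mulVec_eq_sum_ket Φ, mulVec_eq_sum_ket (tensorUnitary _)]
    refine Finset.sum_congr rfl fun w _ => ?_
    by_cases hw : ∀ q, t q = false → w q = z q
    · rw [hΦ w hw]
      congr 1
      ext x
      rw [tensorUnitary_mulVec_ket]
      by_cases hx : x = w
      · simp [hx, signGate]
      · obtain ⟨q, hq⟩ := Function.ne_iff.1 hx
        rw [Finset.prod_eq_zero (f := fun q => (signGate (c q) : Matrix Bool Bool ℂ) (x q) (w q))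
          (Finset.mem_univ q)]
        · simp [hx]
        · simp [signGate, hq]
    · push Not at hw
      obtain ⟨q, hq, hwq⟩ := hw
      rw [hadamardOn, tensorUnitary_mulVec_ket, Finset.prod_eq_zero (Finset.mem_univ q)]
      · simp
      · simp [hq, one_apply, hwq]
  rw [← mulVec_mulVec, ← mulVec_mulVec, h1, mulVec_mulVec, mulVec_mulVec, hadamardOn,
    tensorUnitary_mul, tensorUnitary_mul, ← flipOn_mulVec_ket, flipOn]
  congr 2
  funext q
  simp only [Pi.mul_apply]
  by_cases hq : t q = true
  · simp only [hq, if_true]; rw [hadamard_mul_signGate_mul_hadamard]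
  · have : c q = false := by
      by_contra h
      exact hq (hc q (by simpa using h))
    simp [hq, this, flipGate_false, signGate_false]

/-- A layer of Toffoli gates with supports `S k` and targets `τ k`. -/
theorem Implements.toffoli {P : Finset (Finset Q) → Prop} {κ : Type} [DecidableEq κ] (K : Finset κ)
    (S : κ → Finset Q) (τ : κ → Q) (hτ : ∀ k ∈ K, τ k ∈ S k)
    (hS : ∀ k ∈ K, ∀ l ∈ K, k ≠ l → Disjoint (S k) (S l)) (hP : P (K.image S)) :
    ∃ A, Implements P 1 A ∧ ∀ z : Q → Bool, A *ᵥ ket z = ket fun q =>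
      xor (z q) (decide (∃ k ∈ K, τ k = q ∧ ∀ p ∈ S k, p ≠ q → z p = true)) := by
  set t : Q → Bool := fun q => decide (∃ k ∈ K, τ k = q) with ht
  have hinj : Set.InjOn S K := by
    intro k hk l hl hkl
    by_contra h
    have := hS k hk l hl h
    rw [← hkl] at this
    exact Finset.disjoint_left.1 this (hτ k hk) (hτ k hk)
  have huniq : ∀ k ∈ K, ∀ l ∈ K, τ l ∈ S k → l = k := by
    intro k hk l hl h
    by_contra hne
    exact Finset.disjoint_left.1 (hS l hl k hk hne) (hτ l hl) h
  have hτinj : Set.InjOn τ K := fun k hk l hl h => huniq l hl k hk (h ▸ hτ l hl)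
  have h𝒢 : IsGateLayer (K.image S) := by
    constructor
    · intro T hT
      obtain ⟨k, hk, rfl⟩ := Finset.mem_image.1 hT
      exact ⟨_, hτ k hk⟩
    · intro T hT T' hT' hne
      obtain ⟨k, hk, rfl⟩ := Finset.mem_image.1 hT
      obtain ⟨l, hl, rfl⟩ := Finset.mem_image.1 hT'
      exact hS k hk l hl fun h => hne (h ▸ rfl)
  refine ⟨hadamardOn t * diagonal (gatePhase (K.image S)) * hadamardOn t, ?_, fun z => ?_⟩
  · rw [Matrix.mul_assoc]
    exact (((Implements.phase h𝒢 hP).mul (.tensor _)).tensor_mul _).congr_depth (by simp)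
  · refine kickback t _ z ?_ _ fun w hw => ?_
    · intro q hq
      obtain ⟨k, hk, h, -⟩ := of_decide_eq_true hq
      exact decide_eq_true ⟨k, hk, h⟩
    · rw [diagonal_mulVec_ket]
      congr 1
      rw [gatePhase, Finset.prod_image hinj]
      rw [← Finset.prod_subset (Finset.subset_univ (K.image τ)), Finset.prod_image hτinj]
      · refine Finset.prod_congr rfl fun k hk => ?_
        -- By disjointness of the supports, a control of one gate is never the target of another. So
        -- `w` agrees with `z` on all controls, and the condition can be read off from either.
        have : (∃ l ∈ K, τ l = τ k ∧ ∀ p ∈ S l, p ≠ τ k → z p = true) ↔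
            ∀ p ∈ S k, p ≠ τ k → w p = true := by
          constructor
          · rintro ⟨l, hl, hlk, h⟩ p hp hpk
            obtain rfl := hτinj hl hk hlk
            rw [hw p, h p hp hpk]
            refine decide_eq_false ?_
            rintro ⟨m, hm, rfl⟩
            exact hpk (by rw [huniq l hl m hm hp])
          · intro h
            refine ⟨k, hk, rfl, fun p hp hpk => ?_⟩
            rw [← hw p, h p hp hpk]
            refine decide_eq_false ?_
            rintro ⟨m, hm, rfl⟩
            exact hpk (by rw [huniq k hk m hm hp])
        simp only [this, Bool.and_eq_true, decide_eq_true_eq]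
        congr 1
        refine propext ⟨fun h => ⟨fun p hp _ => h p hp, h _ (hτ k hk)⟩, fun h p hp => ?_⟩
        by_cases hpk : p = τ k
        · rw [hpk]; exact h.2
        · exact h.1 p hp hpk
      · intro q _ hq
        rw [if_neg]
        intro h
        rw [Bool.and_eq_true, decide_eq_true_eq] at h
        obtain ⟨⟨k, hk, h, -⟩, -⟩ := h
        exact hq (Finset.mem_image.2 ⟨k, hk, h⟩)

/-- Addition on `Bool` is xor. As a sum, the parity can be split and reindexed like any finite sum.
-/
theorem parity_eq_sum {n : ℕ} (x : Fin n → Bool) : parity x = ∑ i, x i := by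
  have key : ∀ s : Finset (Fin n),
      decide (Odd (s.filter fun i => x i = true).card) = ∑ i ∈ s, x i := by
    intro s
    induction s using Finset.induction_on with
    | empty => simp; rfl
    | insert a s ha ih =>
      rw [Finset.sum_insert ha, ← ih, Finset.filter_insert]
      cases h : x a
      · simp [Bool.add_eq_xor]
      · simp only [if_true, Bool.add_eq_xor, Bool.true_xor]
        rw [Finset.card_insert_of_notMem (by simp [ha])]
        simp only [Nat.odd_add_one, decide_not]
  exact key _

/-- To synthesize the parity unitary, it is enough to act correctly on the basis vectors. -/
theorem Circuit.synthesizes_parityUnitary {n : ℕ} (C : Circuit Q) (e : Fin (n + 1) ↪ Q)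
    (h : ∀ z : Q → Bool, (∀ q, q ∉ Set.range e → z q = false) →
      C.operator *ᵥ ket z = ket (Function.update z (e (Fin.last n))
        (z (e (Fin.last n)) + ∑ i : Fin n, z (e i.castSucc)))) :
    C.Synthesizes (parityUnitary n) := by
  refine ⟨e, fun φ => ?_⟩
  -- Extension of the input bits by zeros on the ancillas; `withAncilla e` is the linear map induced
  -- by it.
  set f : (Fin (n + 1) → Bool) → Q → Bool := fun y => Function.extend e y fun _ => false with hf
  have hfe : ∀ y, f y ∘ e = y := fun y => funext fun i =>
    e.injective.extend_apply y (fun _ => false) i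
  have hinj : Function.Injective f := fun y y' h => by rw [← hfe y, h, hfe]
  have hanc : ∀ φ, withAncilla e φ = basisMap f *ᵥ φ := by
    intro φ
    ext z
    by_cases hz : ∀ q, q ∉ Finset.univ.map e → z q = false
    · have : z = f (z ∘ e) := by
        ext q
        by_cases hq : ∃ i, e i = q
        · obtain ⟨i, rfl⟩ := hq
          simp [hf, e.injective.extend_apply]
        · rw [hz q (by simpa using hq), hf]
          simp only
          rw [Function.extend_apply' _ _ _ hq]
      rw [withAncilla, if_pos hz]
      conv_rhs => rw [this]
      rw [basisMap_mulVec_apply hinj]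
    · rw [withAncilla, if_neg hz, basisMap_mulVec_apply_of_notMem]
      rintro y rfl
      refine hz fun q hq => ?_
      simp only [hf]
      rw [Function.extend_apply' _ _ _ (by simpa using hq)]
  rw [hanc, hanc]
  refine Intertwines.mulVec (.of_ket fun y => ?_) φ
  have hU : parityUnitary n *ᵥ ket y = ket (Function.update y (Fin.last n)
      (xor (y (Fin.last n)) (parity fun i => y i.castSucc))) := by
    ext x
    simp only [parityUnitary, functionUnitary, mulVec_single_one, col_apply, of_apply,
      Pi.single_apply]
  rw [hU, basisMap_mulVec_ket, h]
  · congr 1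
    have hy : ∀ i, f y (e i) = y i := fun i => congrFun (hfe y) i
    rw [parity_eq_sum]
    simp only [hy]
    ext q
    by_cases hq : ∃ i, e i = q
    · obtain ⟨i, rfl⟩ := hq
      simp only [hf, e.injective.extend_apply]
      by_cases hi : i = Fin.last n
      · subst hi; simp [Bool.add_eq_xor]
      · simp only [Function.update_of_ne hi, Function.update_of_ne (e.injective.ne hi)]
        exact e.injective.extend_apply _ _ _
    · have : q ≠ e (Fin.last n) := fun h => hq ⟨_, h.symm⟩
      simp only [Function.update_of_ne this, hf]
      rw [Function.extend_apply' _ _ _ hq, Function.extend_apply' _ _ _ hq]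
  · intro q hq
    simp only [hf]
    rw [Function.extend_apply' _ _ _ (by simpa using hq)]

end Framework

/-! ### Parity on a line in depth `n` -/

section Line

variable {Q : Type} [Fintype Q] [DecidableEq Q]

theorem bool_add_self (b : Bool) : b + b = 0 := by cases b <;> rfl

theorem Implements.cnot {P : Finset (Finset Q) → Prop} {a b : Q} (hab : a ≠ b)
    (hP : P {{a, b}}) :
    ∃ A, Implements P 1 A ∧ ∀ z : Q → Bool,
      A *ᵥ ket z = ket (Function.update z b (z b + z a)) := by
  obtain ⟨A, hA, h⟩ := Implements.toffoli (P := P) (Finset.univ : Finset Unit) (fun _ => {a, b})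
    (fun _ => b) (by simp) (by simp) (by simpa using hP)
  refine ⟨A, hA, fun z => ?_⟩
  rw [h]
  congr 1
  funext q
  by_cases hq : q = b
  · subst hq; simp [hab, Bool.add_eq_xor]
  · simp [hq, Ne.symm hq]

theorem Implements.cnot_pair {P : Finset (Finset Q) → Prop} {a b a' b' : Q} (hab : a ≠ b)
    (hab' : a' ≠ b') (haa' : a ≠ a') (ha'b : a' ≠ b) (hb'a : b' ≠ a) (hbb' : b ≠ b')
    (hP : P {{a, b}, {a', b'}}) :
    ∃ A, Implements P 1 A ∧ ∀ z : Q → Bool, A *ᵥ ket z = ket fun q =>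
      if q = b then z b + z a else if q = b' then z b' + z a' else z q := by
  obtain ⟨A, hA, h⟩ := Implements.toffoli (P := P) (Finset.univ : Finset Bool)
    (fun k => bif k then {a, b} else {a', b'}) (fun k => bif k then b else b') (by simp)
    (by simp [haa', haa'.symm, ha'b, ha'b.symm, hb'a, hb'a.symm, hbb', hbb'.symm])
    (by simpa [Finset.image_insert, Finset.pair_comm] using hP)
  refine ⟨A, hA, fun z => ?_⟩
  rw [h]
  congr 1
  funext q
  by_cases hq : q = b
  · subst hq; simp [hab, hbb'.symm, Bool.add_eq_xor]
  · by_cases hq' : q = b'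
    · subst hq'; simp [hq, hab', Ne.symm hq, Bool.add_eq_xor]
    · simp [hq, hq', Ne.symm hq, Ne.symm hq']

/-- The sum of the first `l` bits of the arm `a` and the first `r` bits of the arm `c`, not counting
the common end point `a 0 = c 0`. -/
def armSum (a c : ℕ → Q) (l r : ℕ) (z : Q → Bool) : Bool :=
  ∑ i ∈ Finset.range l, z (a (i + 1)) + ∑ i ∈ Finset.range r, z (c (i + 1))

/-- Two paths of qubits `a 0, …, a M` and `c 0, …, c N` that meet in `a 0 = c 0 = t` only, and along
which `CZ` gates may be applied. -/
structure IsArms (L : Finset Q → Prop) (t : Q) (a c : ℕ → Q) (M N : ℕ) : Prop where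
  a_zero : a 0 = t
  c_zero : c 0 = t
  a_inj : ∀ i ≤ M, ∀ j ≤ M, a i = a j → i = j
  c_inj : ∀ i ≤ N, ∀ j ≤ N, c i = c j → i = j
  ne : ∀ i ≤ M, ∀ j ≤ N, a i = c j → i = 0 ∧ j = 0
  a_gate : ∀ i < M, L {a (i + 1), a i}
  c_gate : ∀ i < N, L {c (i + 1), c i}

/-- Some circuit of depth `d` adds the first `l` and `r` bits of the arms to the qubit `t`. -/
def ArmsImplemented (L : Finset Q → Prop) (t : Q) (a c : ℕ → Q) (l r d : ℕ) : Prop :=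
  ∃ A, Implements (fun 𝒢 => ∀ S ∈ 𝒢, L S) d A ∧ ∀ z : Q → Bool,
    A *ᵥ ket z = ket (Function.update z t (z t + armSum a c l r z))

namespace IsArms

variable {L : Finset Q → Prop} {t : Q} {a c : ℕ → Q} {M N : ℕ}

theorem one_zero (h : IsArms L t a c M N) (hM : 1 ≤ M) : ArmsImplemented L t a c 1 0 1 := by
  obtain ⟨A, hA, hz⟩ := Implements.cnot (P := fun 𝒢 => ∀ S ∈ 𝒢, L S) (a := a 1) (b := t)
    (fun h' => by have := h.a_inj 1 hM 0 (by omega) (by rw [h', h.a_zero]); omega)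
    (by simpa [h.a_zero] using h.a_gate 0 hM)
  exact ⟨A, hA, fun z => by simp [hz, armSum]⟩

theorem one_one (h : IsArms L t a c M N) (hM : 1 ≤ M) (hN : 1 ≤ N) :
    ArmsImplemented L t a c 1 1 2 := by
  have hct : c 1 ≠ t :=
    fun h' => by have := h.c_inj 1 hN 0 (by omega) (by rw [h', h.c_zero]); omega
  obtain ⟨A, hA, hz⟩ := h.one_zero hM
  obtain ⟨B, hB, hz'⟩ := Implements.cnot (P := fun 𝒢 => ∀ S ∈ 𝒢, L S) (a := c 1) (b := t) hct
    (by simpa [h.c_zero] using h.c_gate 0 hN)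
  refine ⟨B * A, hB.mul hA, fun z => ?_⟩
  rw [← mulVec_mulVec, hz, hz']
  simp [armSum, hct, add_assoc]

/-- The far bit `a 2` is folded into `a 1`, `a 1` is added to `t`, and the fold is undone. The bit
`c 1` is added to `t` in the same layer as the first fold, which saves the fourth layer. -/
theorem two_one (h : IsArms L t a c M N) (hM : 2 ≤ M) (hN : 1 ≤ N) :
    ArmsImplemented L t a c 2 1 3 := by
  have hct : c 1 ≠ t :=
    fun h' => by have := h.c_inj 1 hN 0 (by omega) (by rw [h', h.c_zero]); omega
  have ha1t : a 1 ≠ t :=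
    fun h' => by have := h.a_inj 1 (by omega) 0 (by omega) (by rw [h', h.a_zero]); omega
  have ha2t : a 2 ≠ t :=
    fun h' => by have := h.a_inj 2 (by omega) 0 (by omega) (by rw [h', h.a_zero]); omega
  have ha21 : a 2 ≠ a 1 := fun h' => by have := h.a_inj 2 (by omega) 1 (by omega) h'; omega
  have ha2c : a 2 ≠ c 1 := fun h' => by have := h.ne 2 (by omega) 1 (by omega) h'; omega
  have ha1c : a 1 ≠ c 1 := fun h' => by have := h.ne 1 (by omega) 1 (by omega) h'; omega
  obtain ⟨A, hA, hz⟩ := h.one_zero (by omega)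
  obtain ⟨B, hB, hz'⟩ := Implements.cnot_pair (P := fun 𝒢 => ∀ S ∈ 𝒢, L S) (a := a 2) (b := a 1)
    (a' := c 1) (b' := t) ha21 hct ha2c ha1c.symm ha2t.symm ha1t (by
      have h1 := h.a_gate 1 (by omega)
      have h2 := h.c_gate 0 hN
      rw [h.c_zero] at h2
      simpa using ⟨h1, h2⟩)
  obtain ⟨D, hD, hz''⟩ := Implements.cnot (P := fun 𝒢 => ∀ S ∈ 𝒢, L S) (a := a 2) (b := a 1) ha21
    (by simpa using h.a_gate 1 (by omega))
  refine ⟨D * (A * B), hD.mul (hA.mul hB), fun z => ?_⟩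
  rw [← mulVec_mulVec, ← mulVec_mulVec, hz', hz, hz'']
  congr 1
  funext q
  by_cases hqt : q = t
  · subst hqt
    simp [armSum, Finset.sum_range_succ, ha1t.symm, ha1t]
    ac_rfl
  · by_cases hq1 : q = a 1
    · subst hq1; simp [armSum, ha1t, ha21, ha2t, add_assoc, bool_add_self]
    · simp [hqt, hq1]

/-- Folding the end bit of each arm into its neighbour makes the sum over the shorter arms equal to
the sum over the longer ones. Both folds fit in one layer, because the neighbours are distinct from
`t` and from each other; repeating this layer restores the arms. -/
theorem succ_succ (h : IsArms L t a c M N) {l r d : ℕ} (hl : l + 2 ≤ M) (hr : r + 2 ≤ N)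
    (hlr : ArmsImplemented L t a c (l + 1) (r + 1) d) :
    ArmsImplemented L t a c (l + 2) (r + 2) (d + 2) := by
  obtain ⟨A, hA, hz⟩ := hlr
  have haa : ∀ {i j}, i ≤ M → j ≤ M → i ≠ j → a i ≠ a j :=
    fun hi hj hij h' => hij (h.a_inj _ hi _ hj h')
  have hcc : ∀ {i j}, i ≤ N → j ≤ N → i ≠ j → c i ≠ c j :=
    fun hi hj hij h' => hij (h.c_inj _ hi _ hj h')
  have hac : ∀ {i j}, i ≤ M → j ≤ N → i ≠ 0 → a i ≠ c j :=
    fun hi hj h0 h' => h0 (h.ne _ hi _ hj h').1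
  have hat : ∀ {i}, i ≤ M → i ≠ 0 → a i ≠ t := fun hi h0 => by
    rw [← h.a_zero]; exact haa hi (by omega) h0
  have hct : ∀ {i}, i ≤ N → i ≠ 0 → c i ≠ t := fun hi h0 => by
    rw [← h.c_zero]; exact hcc hi (by omega) h0
  obtain ⟨B, hB, hz'⟩ := Implements.cnot_pair (P := fun 𝒢 => ∀ S ∈ 𝒢, L S) (a := a (l + 2))
    (b := a (l + 1)) (a' := c (r + 2)) (b' := c (r + 1)) (haa (by omega) (by omega) (by omega))
    (hcc (by omega) (by omega) (by omega)) (hac (by omega) (by omega) (by omega))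
    (hac (by omega) (by omega) (by omega)).symm (hac (by omega) (by omega) (by omega)).symm
    (hac (by omega) (by omega) (by omega)) (by
      have h1 := h.a_gate (l + 1) (by omega)
      have h2 := h.c_gate (r + 1) (by omega)
      simpa using ⟨h1, h2⟩)
  refine ⟨B * (A * B), (hB.mul (hA.mul hB)).congr_depth (by omega), fun z => ?_⟩
  rw [← mulVec_mulVec, ← mulVec_mulVec, hz', hz, hz']
  have hsum : armSum a c (l + 1) (r + 1) (fun q => if q = a (l + 1) then
      z (a (l + 1)) + z (a (l + 2)) else if q = c (r + 1) then z (c (r + 1)) + z (c (r + 2))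
      else z q) = armSum a c (l + 2) (r + 2) z := by
    simp only [armSum]
    rw [Finset.sum_range_succ _ l, Finset.sum_range_succ _ r, Finset.sum_range_succ _ (l + 1),
      Finset.sum_range_succ _ l, Finset.sum_range_succ _ (r + 1), Finset.sum_range_succ _ r,
      if_pos rfl, if_neg (hac (by omega) (by omega) (by omega)).symm, if_pos rfl,
      Finset.sum_congr rfl (g := fun i => z (a (i + 1))),
      Finset.sum_congr (s₁ := Finset.range r) rfl (g := fun i => z (c (i + 1)))]
    · simp only [add_assoc, show l + 1 + 1 = l + 2 from rfl, show r + 1 + 1 = r + 2 from rfl]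
    · intro i hi
      have := Finset.mem_range.1 hi
      rw [if_neg (hac (by omega) (by omega) (by omega)).symm,
        if_neg (hcc (by omega) (by omega) (by omega))]
    · intro i hi
      have := Finset.mem_range.1 hi
      rw [if_neg (haa (by omega) (by omega) (by omega)),
        if_neg (hac (by omega) (by omega) (by omega))]
  rw [hsum]
  congr 1
  funext q
  have e1 : a (l + 2) ≠ t := hat (by omega) (by omega)
  have e2 : c (r + 2) ≠ t := hct (by omega) (by omega)
  have e3 : a (l + 1) ≠ t := hat (by omega) (by omega)
  have e4 : c (r + 1) ≠ t := hct (by omega) (by omega)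
  have e5 : a (l + 2) ≠ a (l + 1) := haa (by omega) (by omega) (by omega)
  have e6 : c (r + 2) ≠ c (r + 1) := hcc (by omega) (by omega) (by omega)
  have e7 : a (l + 2) ≠ c (r + 1) := hac (by omega) (by omega) (by omega)
  have e8 : c (r + 2) ≠ a (l + 1) := (hac (by omega) (by omega) (by omega)).symm
  have e9 : c (r + 1) ≠ a (l + 1) := (hac (by omega) (by omega) (by omega)).symm
  by_cases hqt : q = t
  · subst hqt; simp [e3.symm, e4.symm]
  · by_cases hq1 : q = a (l + 1)
    · subst hq1; simp [e1, e3, e5, e7, add_assoc, bool_add_self]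
    · by_cases hq2 : q = c (r + 1)
      · subst hq2; simp [e2, e4, e6, e8, e9, add_assoc, bool_add_self]
      · simp [hqt, hq1, hq2]

/-- Each round of `succ_succ` adds two to both `n` and the depth. It needs two nonempty arms before
the round, so the case of arms `(1, 0)` cannot start the odd induction and `n = 3` is a separate
base case. -/
theorem implemented (h : IsArms L t a c M N) (n : ℕ) (hn : 1 ≤ n) (hM : (n + 1) / 2 ≤ M)
    (hN : n / 2 ≤ N) : ArmsImplemented L t a c ((n + 1) / 2) (n / 2) n := by
  induction n using Nat.strong_induction_on with
  | _ n ih =>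
    rcases (by omega : n = 1 ∨ n = 2 ∨ n = 3 ∨ 4 ≤ n) with rfl | rfl | rfl | h4
    · exact h.one_zero hM
    · exact h.one_one (by omega) (by omega)
    · exact h.two_one (by omega) (by omega)
    · obtain ⟨l, hl⟩ : ∃ l, (n + 1) / 2 = l + 2 := ⟨(n + 1) / 2 - 2, by omega⟩
      obtain ⟨r, hr⟩ : ∃ r, n / 2 = r + 2 := ⟨n / 2 - 2, by omega⟩
      obtain ⟨m, rfl⟩ : ∃ m, n = m + 2 := ⟨n - 2, by omega⟩
      have := ih m (by omega) (by omega) (by omega) (by omega)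
      rw [show (m + 1) / 2 = l + 1 by omega, show m / 2 = r + 1 by omega] at this
      rw [hl, hr]
      exact h.succ_succ (by omega) (by omega) this

end IsArms

theorem Implements.exists_circuit2D {w m d : ℕ} {A : Operator (Fin w × Fin m)}
    (h : Implements (fun 𝒢 => ∀ S ∈ 𝒢, IsLineInterval S) d A) :
    ∃ C : Circuit2D w m, C.depth = d ∧ C.operator = A := by
  obtain ⟨C, hC, hd, hA⟩ := h.exists_circuit
  exact ⟨⟨C, hC⟩, hd, hA⟩

theorem exists_circuit1D (n : ℕ) (hn : 1 ≤ n) :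
    ∃ C : Circuit1D (n + 1), C.depth = n ∧ C.Synthesizes (parityUnitary n) := by
  set l := (n + 1) / 2 with hl
  set r := n / 2 with hr
  have hlr : l + r = n := by omega
  let pt : ℕ → Fin 1 × Fin (n + 1) := fun i => (0, ⟨min i n, by omega⟩)
  have hpt : ∀ {i j}, i ≤ n → j ≤ n → pt i = pt j → i = j := by
    intro i j hi hj h
    simp only [pt, Prod.mk.injEq, Fin.mk.injEq, true_and] at h
    omega
  have hgate : ∀ i < n, IsLineInterval {pt i, pt (i + 1)} := by
    intro i hi
    refine Or.inl ⟨0, (pt i).2, (pt (i + 1)).2, ?_⟩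
    ext ⟨x, y⟩
    simp only [pt, Finset.mem_insert, Finset.mem_singleton, Finset.mem_product, Finset.mem_Icc,
      Prod.mk.injEq, Fin.ext_iff, Fin.le_def]
    omega
  have harms : IsArms IsLineInterval (pt l) (fun i => pt (l - i)) (fun i => pt (l + i)) l r :=
    { a_zero := rfl
      c_zero := rfl
      a_inj := fun i hi j hj h => by have := hpt (by omega) (by omega) h; omega
      c_inj := fun i hi j hj h => by have := hpt (by omega) (by omega) h; omega
      ne := fun i hi j hj h => by have := hpt (by omega) (by omega) h; omega
      a_gate := fun i hi => by
        have := hgate (l - (i + 1)) (by omega)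
        rwa [show l - (i + 1) + 1 = l - i by omega] at this
      c_gate := fun i hi => by
        have := hgate (l + i) (by omega)
        rwa [Finset.pair_comm] at this }
  obtain ⟨A, hA, hz⟩ := harms.implemented n hn le_rfl le_rfl
  obtain ⟨C, hd, hC⟩ := hA.exists_circuit2D
  refine ⟨C, hd, ?_⟩
  -- The swap puts the target in the middle of the row and the input displaced by it at the end.
  let e : Fin (n + 1) ↪ Fin 1 × Fin (n + 1) :=
    ⟨fun i => (0, Equiv.swap (Fin.last n) (pt l).2 i), fun i j h => by
      simpa using h⟩
  refine Circuit.synthesizes_parityUnitary _ e fun z _ => ?_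
  have hlast : e (Fin.last n) = pt l :=
    Prod.ext rfl (Equiv.swap_apply_left _ _)
  rw [hC, hz, hlast]
  congr 3
  -- With the bit of the target added, both sides become the sum over the whole row, and no
  -- reindexing around the middle is needed.
  apply add_right_cancel (b := z (pt l))
  trans ∑ i ∈ Finset.range (n + 1), z (pt i)
  · change armSum _ _ l r z + _ = _
    rw [show Finset.range (n + 1) = Finset.range (l + (r + 1)) by congr 1; omega,
      Finset.sum_range_add, Finset.sum_range_succ',
      ← Finset.sum_range_reflect, armSum]
    simp only [add_zero, ← add_assoc]
    congr 2
    refine Finset.sum_congr rfl fun i hi => ?_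
    rw [show l - 1 - i = l - (i + 1) by omega]
  · rw [← hlast, ← Fin.sum_univ_castSucc fun i => z (e i),
      Finset.sum_range fun i => z (pt i),
      ← Equiv.sum_comp (Equiv.swap (Fin.last n) (pt l).2)]
    refine Finset.sum_congr rfl fun i _ => ?_
    exact congrArg z (Prod.ext rfl (Fin.ext (min_eq_left (Nat.lt_succ_iff.1 (Fin.isLt _)))))

end Line

/-! ### Routing a layer of gates on a lattice -/

section Lattice

variable {w m : ℕ}

/-- The gates of `𝒢` can be assigned to `w` tracks such that gates on the same track are contained
in disjoint intervals. -/
def IsRoutable (w : ℕ) (𝒢 : Finset (Finset (Fin m))) : Prop :=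
  ∃ (r : Finset (Fin m) → Fin w) (lo hi : Finset (Fin m) → Fin m),
    (∀ S ∈ 𝒢, S ⊆ Finset.Icc (lo S) (hi S)) ∧
    ∀ S ∈ 𝒢, ∀ T ∈ 𝒢, S ≠ T → r S = r T →
      Disjoint (Finset.Icc (lo S) (hi S)) (Finset.Icc (lo T) (hi T))

/-- The state of the lattice with `z` in row `0` and ones in all other rows. -/
def latticeState (w : ℕ) (z : Fin m → Bool) : Fin (w + 1) × Fin m → Bool :=
  fun p => if p.1 = 0 then z p.2 else true

theorem latticeState_injective : Function.Injective (latticeState w : (Fin m → Bool) → _) :=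
  fun z z' h => funext fun i => by simpa [latticeState] using congrFun h (0, i)

/-- In each column `i ∈ K`, copy the qubit in row `0` to row `ρ i`, or erase this copy, by a layer of
gates on column intervals. -/
theorem exists_copyLayer (K : Finset (Fin m)) (ρ : Fin m → Fin (w + 1)) (hρ : ∀ i ∈ K, ρ i ≠ 0) :
    ∃ V, Implements (fun 𝒢 => ∀ S ∈ 𝒢, IsLineInterval S) 1 V ∧ ∀ y : Fin (w + 1) × Fin m → Bool,
      (∀ a i, a ≠ 0 → ¬(i ∈ K ∧ ρ i = a) → y (a, i) = true) →
      V *ᵥ ket y = ket fun q => if q.2 ∈ K ∧ ρ q.2 = q.1 then xor (y q) (!y (0, q.2)) else y q := by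
  obtain ⟨A, hA, h⟩ := Implements.toffoli (P := fun 𝒢 => ∀ S ∈ 𝒢, IsLineInterval S) K
    (fun i => Finset.Icc 0 (ρ i) ×ˢ {i}) (fun i => (ρ i, i)) (by simp)
    (fun k _ l _ hkl => Finset.disjoint_product.2 (Or.inr (by simpa using hkl)))
    (fun S hS => by
      obtain ⟨i, -, rfl⟩ := Finset.mem_image.1 hS
      exact Or.inr ⟨0, ρ i, i, rfl⟩)
  -- The inner qubits of the column interval are ones, so the Toffoli gate adds the bit of row `0`
  -- alone. The `X` gate adds one more, so a qubit that was one becomes a copy of row `0`, and a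
  -- copy becomes one again: the same layer copies and erases.
  refine ⟨flipOn (fun q => decide (q.2 ∈ K ∧ ρ q.2 = q.1)) * A, hA.tensor_mul _, fun y hy => ?_⟩
  rw [← mulVec_mulVec, h, flipOn_mulVec_ket]
  congr 1
  funext q
  obtain ⟨a, i⟩ := q
  by_cases hq : i ∈ K ∧ ρ i = a
  · obtain ⟨hi, rfl⟩ := hq
    have : (∃ k ∈ K, (ρ k, k) = (ρ i, i) ∧ ∀ p ∈ Finset.Icc 0 (ρ k) ×ˢ {k}, p ≠ (ρ i, i) →
        y p = true) ↔ y (0, i) = true := by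
      constructor
      · rintro ⟨k, -, hk, hp⟩
        obtain rfl : k = i := (Prod.mk.inj hk).2
        exact hp (0, k) (by simp) fun h' => hρ k hi (Prod.mk.inj h').1.symm
      · intro h0
        refine ⟨i, hi, rfl, ?_⟩
        rintro ⟨b, j⟩ hp hne
        obtain ⟨-, hj⟩ := Finset.mem_product.1 hp
        obtain rfl : j = i := by simpa using hj
        by_cases hb : b = 0
        · rw [hb, h0]
        · exact hy b j hb fun h' => hne (by rw [h'.2])
    simp only [this, hi, Bool.decide_eq_true, and_self, decide_true, if_true]
    cases y (ρ i, i) <;> cases y (0, i) <;> rfl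
  · have : ¬∃ k ∈ K, (ρ k, k) = (a, i) ∧ ∀ p ∈ Finset.Icc 0 (ρ k) ×ˢ {k}, p ≠ (a, i) →
        y p = true := by
      rintro ⟨k, hk, hka, -⟩
      obtain ⟨rfl, rfl⟩ := Prod.mk.inj hka
      exact hq ⟨hk, rfl⟩
    simp only [this, hq, decide_false, Bool.xor_false, if_false]

/-- Three layers: copy each qubit to the row of its gate, apply the gates as full row intervals,
erase the copies. Enlarging a gate to an interval is harmless, because the additional qubits are
ones. -/
theorem exists_latticePhase {𝒢 : Finset (Finset (Fin m))} (h𝒢 : IsGateLayer 𝒢)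
    (hr : IsRoutable w 𝒢) :
    ∃ A, Implements (fun 𝒢 => ∀ S ∈ 𝒢, IsLineInterval S) 3 A ∧
      ∀ z : Fin m → Bool, A *ᵥ ket (latticeState w z) = gatePhase 𝒢 z • ket (latticeState w z) := by
  obtain ⟨r, lo, hi, hsub, hdis⟩ := hr
  set K : Finset (Fin m) := Finset.univ.filter fun i => ∃ S ∈ 𝒢, i ∈ S with hK
  have hρ' : ∀ i, ∃ a : Fin (w + 1), ∀ S ∈ 𝒢, i ∈ S → a = (r S).succ := by
    intro i
    by_cases h : ∃ S ∈ 𝒢, i ∈ S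
    · obtain ⟨S, hS, hiS⟩ := h
      refine ⟨(r S).succ, fun T hT hiT => ?_⟩
      by_cases hST : S = T
      · rw [hST]
      · exact absurd hiT (Finset.disjoint_left.1 (h𝒢.2 S hS T hT hST) hiS)
    · exact ⟨0, fun S hS hiS => absurd ⟨S, hS, hiS⟩ h⟩
  choose ρ hρ using hρ'
  have hKmem : ∀ {i}, i ∈ K ↔ ∃ S ∈ 𝒢, i ∈ S := by simp [hK]
  have hρ0 : ∀ i ∈ K, ρ i ≠ 0 := by
    intro i hi
    obtain ⟨S, hS, hiS⟩ := hKmem.1 hi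
    rw [hρ i S hS hiS]
    exact Fin.succ_ne_zero _
  obtain ⟨V, hV, hVz⟩ := exists_copyLayer K ρ hρ0
  set G : Finset (Fin m) → Finset (Fin (w + 1) × Fin m) :=
    fun S => {(r S).succ} ×ˢ Finset.Icc (lo S) (hi S) with hG
  have hGdis : ∀ S ∈ 𝒢, ∀ T ∈ 𝒢, S ≠ T → Disjoint (G S) (G T) := by
    intro S hS T hT hST
    refine Finset.disjoint_product.2 ?_
    by_cases h : r S = r T
    · exact Or.inr (hdis S hS T hT hST h)
    · exact Or.inl (by simpa using h)
  have hGne : ∀ S ∈ 𝒢, (G S).Nonempty := fun S hS =>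
    Finset.Nonempty.product (Finset.singleton_nonempty _) ((h𝒢.1 S hS).mono (hsub S hS))
  have hGinj : Set.InjOn G 𝒢 := by
    intro S hS T hT hST
    by_contra h
    have := hGdis S hS T hT h
    rw [← hST, disjoint_self] at this
    exact (hGne S hS).ne_empty this
  have h𝒢' : IsGateLayer (𝒢.image G) := by
    constructor
    · intro S hS
      obtain ⟨S, hS', rfl⟩ := Finset.mem_image.1 hS
      exact hGne S hS'
    · intro S hS T hT hne
      obtain ⟨S, hS', rfl⟩ := Finset.mem_image.1 hS
      obtain ⟨T, hT', rfl⟩ := Finset.mem_image.1 hT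
      exact hGdis S hS' T hT' fun h => hne (h ▸ rfl)
  have hM : Implements (fun 𝒢 => ∀ S ∈ 𝒢, IsLineInterval S) 1
      (diagonal (gatePhase (𝒢.image G))) := by
    refine Implements.phase h𝒢' fun S hS => ?_
    obtain ⟨S, -, rfl⟩ := Finset.mem_image.1 hS
    exact Or.inl ⟨_, _, _, rfl⟩
  refine ⟨V * (diagonal (gatePhase (𝒢.image G)) * V), hV.mul (hM.mul hV), fun z => ?_⟩
  rw [← mulVec_mulVec, ← mulVec_mulVec, hVz _ fun a i ha _ => by simp [latticeState, ha]]
  set y : Fin (w + 1) × Fin m → Bool := fun q => if q.2 ∈ K ∧ ρ q.2 = q.1 then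
    xor (latticeState w z q) (!latticeState w z (0, q.2)) else latticeState w z q with hy
  have hycopy : ∀ i ∈ K, y (ρ i, i) = z i := by
    intro i hi
    simp [hy, hi, latticeState, hρ0 i hi]
  have hyone : ∀ a i, a ≠ 0 → ¬(i ∈ K ∧ ρ i = a) → y (a, i) = true := by
    intro a i ha h
    simp only [hy, h, if_false]
    simp [latticeState, ha]
  have hy0 : ∀ i, y (0, i) = z i := by
    intro i
    have : ¬(i ∈ K ∧ ρ i = 0) := fun h => hρ0 i h.1 h.2
    simp only [hy, this, if_false]
    simp [latticeState]
  have hphase : gatePhase (𝒢.image G) y = gatePhase 𝒢 z := by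
    rw [gatePhase, gatePhase, Finset.prod_image hGinj]
    refine Finset.prod_congr rfl fun S hS => ?_
    congr 1
    refine propext ⟨fun h i hiS => ?_, fun h p hp => ?_⟩
    · have hiK : i ∈ K := hKmem.2 ⟨S, hS, hiS⟩
      rw [← hycopy i hiK]
      exact h _ (Finset.mem_product.2 ⟨by simp [hρ i S hS hiS], hsub S hS hiS⟩)
    · obtain ⟨a, i⟩ := p
      obtain ⟨ha, hi⟩ := Finset.mem_product.1 hp
      obtain rfl : a = (r S).succ := by simpa using ha
      by_cases hiK : i ∈ K ∧ ρ i = (r S).succ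
      · obtain ⟨T, hT, hiT⟩ := hKmem.1 hiK.1
        -- A copy in the row and interval of `S` comes from a gate on the same track whose interval
        -- meets that of `S`, hence from `S` itself.
        obtain rfl : S = T := by
          by_contra hST
          refine Finset.disjoint_left.1 (hdis S hS T hT hST ?_) hi (hsub T hT hiT)
          have := hiK.2
          rw [hρ i T hT hiT] at this
          exact (Fin.succ_injective _ this).symm
        rw [← hiK.2, hycopy i hiK.1, h i hiT]
      · exact hyone _ i (Fin.succ_ne_zero _) hiK
  rw [diagonal_mulVec_ket, mulVec_smul, hphase, hVz _ hyone]
  congr 2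
  funext ⟨a, i⟩
  by_cases h : i ∈ K ∧ ρ i = a
  · obtain ⟨hi, rfl⟩ := h
    simp [hi, hycopy, hy0, latticeState, hρ0]
  · simp only [h, if_false]
    by_cases ha : a = 0
    · subst ha; simp [hy0, latticeState]
    · rw [hyone a i ha h]; simp [latticeState, ha]

theorem intertwines_latticeState_tensorUnitary (w : ℕ) (u : Fin m → unitaryGroup Bool ℂ) :
    Intertwines (latticeState w)
      (tensorUnitary fun p : Fin (w + 1) × Fin m => if p.1 = 0 then u p.2 else 1)
      (tensorUnitary u) := by
  refine .of_ket fun z => ?_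
  ext y
  rw [tensorUnitary_mulVec_ket, Fintype.prod_prod_type, Fin.prod_univ_succ]
  by_cases h : ∃ x, y = latticeState w x
  · obtain ⟨x, rfl⟩ := h
    rw [basisMap_mulVec_apply latticeState_injective, tensorUnitary_mulVec_ket]
    simp [latticeState]
  · rw [basisMap_mulVec_apply_of_notMem _ fun x hx => h ⟨x, hx⟩]
    have : ∃ a i, y (Fin.succ a, i) = false := by
      by_contra! h'
      refine h ⟨fun i => y (0, i), funext fun ⟨a, i⟩ => ?_⟩
      refine Fin.cases (by simp [latticeState]) (fun b => ?_) a
      simpa [latticeState] using h' b i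
    obtain ⟨a, i, hai⟩ := this
    rw [Finset.prod_eq_zero (Finset.mem_univ a), mul_zero]
    rw [Finset.prod_eq_zero (Finset.mem_univ i)]
    simp [hai, latticeState, one_apply]

/-- A circuit with routable layers can be simulated on a lattice: the qubits are placed in row `0`
and the other rows are initialized to one. -/
theorem Implements.exists_lattice {d : ℕ} {A : Operator (Fin m)}
    (h : Implements (IsRoutable w) d A) :
    ∃ A', Implements (fun 𝒢 => ∀ S ∈ 𝒢, IsLineInterval S) (3 * d) A' ∧
      Intertwines (latticeState w) A' A := by
  induction h with
  | tensor u => exact ⟨_, .tensor _, intertwines_latticeState_tensorUnitary w u⟩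
  | layer u 𝒢 h𝒢 hP _ ih =>
    obtain ⟨A', hA', h⟩ := ih
    obtain ⟨M, hM, hMz⟩ := exists_latticePhase h𝒢 hP
    refine ⟨_, ((hM.mul hA').tensor_mul
      fun p => if p.1 = 0 then u p.2 else 1).congr_depth (by ring), ?_⟩
    have hM' : Intertwines (latticeState w) M (diagonal (gatePhase 𝒢)) := by
      refine .of_ket fun z => ?_
      rw [hMz, diagonal_mulVec_ket, mulVec_smul, basisMap_mulVec_ket]
    rw [Matrix.mul_assoc]
    exact (intertwines_latticeState_tensorUnitary w u).mul (hM'.mul h)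

/-- If a circuit with routable layers computes the parity of the qubits `e i` into `e (last n)`,
then so does a circuit on a lattice. -/
theorem exists_circuit2D_of_routable {n d : ℕ} {A : Operator (Fin m)}
    (h : Implements (IsRoutable w) d A) (e : Fin (n + 1) ↪ Fin m)
    (hA : ∀ z : Fin m → Bool, (∀ q, q ∉ Set.range e → z q = false) →
      A *ᵥ ket z = ket (Function.update z (e (Fin.last n))
        (z (e (Fin.last n)) + ∑ i : Fin n, z (e i.castSucc)))) :
    ∃ C : Circuit2D (w + 1) m, C.depth = 3 * d ∧ C.Synthesizes (parityUnitary n) := by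
  obtain ⟨A', hA', hint⟩ := h.exists_lattice
  -- Ancillas start at zero but the simulation wants ones outside row `0`; `F` switches between the
  -- two at no cost in depth.
  set F : Operator (Fin (w + 1) × Fin m) := flipOn fun p => decide (p.1 ≠ 0) with hF
  have hF' : Implements (fun 𝒢 => ∀ S ∈ 𝒢, IsLineInterval S) 0 F := .tensor _
  obtain ⟨C, hd, hC⟩ := (hF'.mul (hA'.mul hF')).exists_circuit2D
  refine ⟨C, by simpa using hd, ?_⟩
  let e' : Fin (n + 1) ↪ Fin (w + 1) × Fin m :=
    ⟨fun i => (0, e i), fun i j h => e.injective (Prod.mk.inj h).2⟩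
  refine Circuit.synthesizes_parityUnitary _ e' fun z hz => ?_
  have he' : ∀ i, e' i = (0, e i) := fun _ => rfl
  have hz1 : ∀ a i, a ≠ 0 → z (a, i) = false := by
    intro a i ha
    refine hz _ ?_
    rintro ⟨j, hj⟩
    exact ha (Prod.mk.inj hj).1.symm
  have hFz : ∀ x : Fin (w + 1) × Fin m → Bool, (∀ a i, a ≠ 0 → x (a, i) = false) →
      (fun q : Fin (w + 1) × Fin m => xor (x q) (decide (q.1 ≠ 0))) =
        latticeState w fun i => x (0, i) := by
    intro x hx
    funext ⟨a, i⟩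
    by_cases ha : a = 0
    · subst ha; simp [latticeState]
    · simp [latticeState, ha, hx]
  rw [hC, ← mulVec_mulVec, ← mulVec_mulVec, hF, flipOn_mulVec_ket, hFz z hz1,
    ← basisMap_mulVec_ket, hint.mulVec, hA, basisMap_mulVec_ket,
    flipOn_mulVec_ket]
  · congr 1
    funext ⟨a, i⟩
    by_cases ha : a = 0
    · subst ha
      by_cases hi : i = e (Fin.last n)
      · subst hi; simp [latticeState, he']
      · have : ((0 : Fin (w + 1)), i) ≠ e' (Fin.last n) := fun h => hi (Prod.mk.inj h).2
        simp [latticeState, Function.update_of_ne hi, Function.update_of_ne this]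
    · have : (a, i) ≠ e' (Fin.last n) := fun h => ha (Prod.mk.inj h).1
      simp [latticeState, ha, Function.update_of_ne this, hz1]
  · intro q hq
    refine hz _ ?_
    rintro ⟨j, hj⟩
    exact hq ⟨j, (Prod.mk.inj hj).2⟩

end Lattice

/-! ### Parity by a tree of block sums -/

section Tree

variable {Q : Type} [Fintype Q] [DecidableEq Q]

theorem sum_range_mul {β : Type} [AddCommMonoid β] (g : ℕ → β) (k M : ℕ) :
    ∑ q ∈ Finset.range ((k + 1) * M), g q =
      ∑ p ∈ Finset.range M,
        (g ((k + 1) * p) + ∑ i ∈ Finset.range k, g ((k + 1) * p + i + 1)) := by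
  induction M with
  | zero => simp
  | succ M ih =>
    rw [Nat.mul_succ, Finset.sum_range_add, ih, Finset.sum_range_succ _ M,
      Finset.sum_range_succ' _ k, add_zero, add_comm (g ((k + 1) * M))]
    simp only [add_assoc]

/-- For each `p < M`, add to the bit with index `(k + 1) * p * s` the `k` bits at the following
multiples of `s`. -/
def blockSum (δ : ℕ → Q) (k s M : ℕ) (z : Q → Bool) : Q → Bool :=
  fun q => z q + ∑ p ∈ Finset.range M, if q = δ ((k + 1) * p * s) then
    ∑ i ∈ Finset.range k, z (δ (((k + 1) * p + i + 1) * s)) else 0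

theorem blockSum_of_ne {δ : ℕ → Q} {k s M : ℕ} {q : Q}
    (hq : ∀ p < M, q ≠ δ ((k + 1) * p * s)) (z : Q → Bool) : blockSum δ k s M z q = z q := by
  rw [blockSum, Finset.sum_eq_zero, add_zero]
  intro p hp
  rw [if_neg (hq p (Finset.mem_range.1 hp))]

section

variable {δ : ℕ → Q} {k s M N : ℕ}

theorem block_index_lt (hN : (k + 1) * M * s ≤ N) (hs : 1 ≤ s) {p i : ℕ} (hp : p < M)
    (hi : i ≤ k) : ((k + 1) * p + i) * s < N := by
  refine lt_of_lt_of_le (Nat.mul_lt_mul_of_pos_right ?_ hs) hN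
  calc (k + 1) * p + i < (k + 1) * p + (k + 1) := by omega
    _ = (k + 1) * (p + 1) := by ring
    _ ≤ (k + 1) * M := Nat.mul_le_mul_left _ hp

theorem block_index_inj (hs : 1 ≤ s) {p i p' i' : ℕ} (hi : i ≤ k) (hi' : i' ≤ k)
    (h : ((k + 1) * p + i) * s = ((k + 1) * p' + i') * s) : p = p' ∧ i = i' := by
  have h := Nat.eq_of_mul_eq_mul_right hs h
  have h1 := congrArg (· / (k + 1)) h
  have h2 := congrArg (· % (k + 1)) h
  simp only [Nat.mul_add_div (Nat.succ_pos k), Nat.mul_add_mod,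
    Nat.div_eq_of_lt (Nat.lt_succ_of_le hi), Nat.div_eq_of_lt (Nat.lt_succ_of_le hi'),
    Nat.mod_eq_of_lt (Nat.lt_succ_of_le hi), Nat.mod_eq_of_lt (Nat.lt_succ_of_le hi')] at h1 h2
  exact ⟨by simpa using h1, h2⟩

theorem blockSum_head (hδ : ∀ i ≤ N, ∀ j ≤ N, δ i = δ j → i = j) (hs : 1 ≤ s)
    (hN : (k + 1) * M * s ≤ N) {p : ℕ} (hp : p < M) (z : Q → Bool) :
    blockSum δ k s M z (δ ((k + 1) * p * s)) =
      z (δ ((k + 1) * p * s)) + ∑ i ∈ Finset.range k, z (δ (((k + 1) * p + i + 1) * s)) := by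
  rw [blockSum, Finset.sum_eq_single_of_mem p (Finset.mem_range.2 hp), if_pos rfl]
  intro p' hp' hne
  rw [if_neg]
  intro h
  have hp' := Finset.mem_range.1 hp'
  have := hδ _ (block_index_lt hN hs hp (Nat.zero_le _)).le _
    (block_index_lt hN hs hp' (Nat.zero_le _)).le h
  exact hne (block_index_inj (i := 0) (i' := 0) hs (Nat.zero_le _) (Nat.zero_le _) this).1.symm

theorem blockSum_child (hδ : ∀ i ≤ N, ∀ j ≤ N, δ i = δ j → i = j) (hs : 1 ≤ s)
    (hN : (k + 1) * M * s ≤ N) {p i : ℕ} (hp : p < M) (hi : i < k) (z : Q → Bool) :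
    blockSum δ k s M z (δ (((k + 1) * p + i + 1) * s)) = z (δ (((k + 1) * p + i + 1) * s)) := by
  refine blockSum_of_ne (fun p' hp' h => ?_) z
  have := hδ _ (block_index_lt (i := i + 1) hN hs hp hi).le _
    (block_index_lt (i := 0) hN hs hp' (Nat.zero_le _)).le h
  exact absurd (block_index_inj (i := i + 1) (i' := 0) hs hi (Nat.zero_le _) this).2
    (Nat.succ_ne_zero _)

/-- If every layer of blocks can be summed in depth `c`, then the parity of `(k + 1) ^ L` bits can be
computed in depth `2 * c * L + c₀`, by a tree of such layers. -/
theorem exists_tree {P : Finset (Finset Q) → Prop} {L c c₀ : ℕ} {anc : Set Q}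
    (hδ : ∀ i ≤ (k + 1) ^ L, ∀ j ≤ (k + 1) ^ L, δ i = δ j → i = j)
    (hanc : ∀ i ≤ (k + 1) ^ L, δ i ∉ anc)
    (hblock : ∀ s M, 1 ≤ s → (k + 1) * M * s ≤ (k + 1) ^ L →
      ∃ A, Implements P c A ∧ ∀ z : Q → Bool, (∀ q ∈ anc, z q = false) →
        A *ᵥ ket z = ket (blockSum δ k s M z))
    (hbase : ∃ A, Implements P c₀ A ∧ ∀ z : Q → Bool, A *ᵥ ket z =
      ket (Function.update z (δ ((k + 1) ^ L)) (z (δ ((k + 1) ^ L)) + z (δ 0)))) :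
    ∃ A, Implements P (2 * c * L + c₀) A ∧ ∀ z : Q → Bool, (∀ q ∈ anc, z q = false) →
      A *ᵥ ket z = ket (Function.update z (δ ((k + 1) ^ L))
        (z (δ ((k + 1) ^ L)) + ∑ q ∈ Finset.range ((k + 1) ^ L), z (δ q))) := by
  set t := δ ((k + 1) ^ L) with ht
  -- The stride is generalized: the first bits of the blocks at stride `s` are the leaves of a tree
  -- with one level less at stride `(k + 1) * s`.
  have key : ∀ j s, (k + 1) ^ j * s = (k + 1) ^ L →
      ∃ A, Implements P (2 * c * j + c₀) A ∧ ∀ z : Q → Bool, (∀ q ∈ anc, z q = false) →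
        A *ᵥ ket z = ket (Function.update z t
          (z t + ∑ q ∈ Finset.range ((k + 1) ^ j), z (δ (q * s)))) := by
    intro j
    induction j with
    | zero =>
      intro s _
      obtain ⟨A, hA, hz⟩ := hbase
      exact ⟨A, hA.congr_depth (by ring), fun z _ => by simp [hz]⟩
    | succ j ih =>
      intro s hs'
      have hs : 1 ≤ s := by
        rcases Nat.eq_zero_or_pos s with rfl | h
        · exact absurd hs'.symm (by simp)
        · exact h
      have hN : (k + 1) * (k + 1) ^ j * s ≤ (k + 1) ^ L := by rw [← hs', pow_succ']
      obtain ⟨A, hA, hAz⟩ := ih ((k + 1) * s) (by rw [← hs']; ring)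
      obtain ⟨V, hV, hVz⟩ := hblock s ((k + 1) ^ j) hs hN
      refine ⟨V * (A * V), (hV.mul (hA.mul hV)).congr_depth (by ring), fun z hz => ?_⟩
      have hne : ∀ {p i : ℕ}, p < (k + 1) ^ j → i ≤ k → δ (((k + 1) * p + i) * s) ≠ t := by
        intro p i hp hi h
        have hlt := block_index_lt hN hs hp hi
        exact hlt.ne (hδ _ hlt.le _ le_rfl h)
      have hgood : ∀ q ∈ anc, blockSum δ k s ((k + 1) ^ j) z q = false := by
        intro q hq
        rw [blockSum_of_ne, hz q hq]
        rintro p hp rfl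
        exact hanc _ (block_index_lt (i := 0) hN hs hp (Nat.zero_le _)).le hq
      have htb : ∀ z, blockSum δ k s ((k + 1) ^ j) z t = z t :=
        fun z => blockSum_of_ne (fun p hp => (hne (i := 0) hp (Nat.zero_le _)).symm) z
      have hsum : ∑ q ∈ Finset.range ((k + 1) ^ j),
          blockSum δ k s ((k + 1) ^ j) z (δ (q * ((k + 1) * s))) =
          ∑ q ∈ Finset.range ((k + 1) ^ (j + 1)), z (δ (q * s)) := by
        rw [pow_succ', sum_range_mul fun q => z (δ (q * s))]
        refine Finset.sum_congr rfl fun p hp => ?_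
        rw [show p * ((k + 1) * s) = (k + 1) * p * s by ring,
          blockSum_head hδ hs hN (Finset.mem_range.1 hp)]
      rw [← mulVec_mulVec, ← mulVec_mulVec, hVz z hz, hAz _ hgood, hVz, hsum, htb]
      · congr 1
        set b := z t + ∑ q ∈ Finset.range ((k + 1) ^ (j + 1)), z (δ (q * s)) with hb
        funext q
        by_cases hqt : q = t
        · subst hqt
          rw [htb]
          simp
        · rw [Function.update_of_ne hqt]
          by_cases hq : ∃ p < (k + 1) ^ j, q = δ ((k + 1) * p * s)
          · obtain ⟨p, hp, rfl⟩ := hq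
            rw [blockSum_head hδ hs hN hp, Function.update_of_ne hqt, blockSum_head hδ hs hN hp,
              add_assoc]
            -- The recursive call changes only `t`, and a level does not change the bits it reads.
            -- So the second application adds the same bits to each head again, and they cancel.
            convert add_zero _ using 2
            convert bool_add_self _ using 2
            refine Finset.sum_congr rfl fun i hi => ?_
            have hi := Finset.mem_range.1 hi
            rw [Function.update_of_ne (a := δ (((k + 1) * p + i + 1) * s)) (hne (i := i + 1) hp hi),
              blockSum_child hδ hs hN hp hi]
          · push Not at hq
            rw [blockSum_of_ne hq, Function.update_of_ne hqt, blockSum_of_ne hq]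
      · intro q hq
        rw [Function.update_of_ne, hgood q hq]
        rintro rfl
        exact hanc _ le_rfl hq
  simpa using key L 1 (by simp)

/-- The case `k = 1`, in which the blocks are pairs of qubits, is a layer of `CNOT` gates. -/
theorem Implements.blockSum_one {P : Finset (Finset Q) → Prop} {δ : ℕ → Q} {s M N : ℕ}
    (hδ : ∀ i ≤ N, ∀ j ≤ N, δ i = δ j → i = j) (hs : 1 ≤ s) (hN : (1 + 1) * M * s ≤ N)
    (hP : P ((Finset.range M).image fun p => {δ ((1 + 1) * p * s), δ (((1 + 1) * p + 1) * s)})) :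
    ∃ A, Implements P 1 A ∧ ∀ z : Q → Bool, A *ᵥ ket z = ket (blockSum δ 1 s M z) := by
  have hinj : ∀ {p i p' i' : ℕ}, p < M → p' < M → i ≤ 1 → i' ≤ 1 →
      δ (((1 + 1) * p + i) * s) = δ (((1 + 1) * p' + i') * s) → p = p' ∧ i = i' :=
    fun hp hp' hi hi' h => block_index_inj hs hi hi'
      (hδ _ (block_index_lt hN hs hp hi).le _ (block_index_lt hN hs hp' hi').le h)
  obtain ⟨A, hA, hAz⟩ := Implements.toffoli (P := P) (Finset.range M)
    (fun p => {δ ((1 + 1) * p * s), δ (((1 + 1) * p + 1) * s)}) (fun p => δ ((1 + 1) * p * s))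
    (by simp)
    (fun p hp p' hp' hne => by
      have hp := Finset.mem_range.1 hp
      have hp' := Finset.mem_range.1 hp'
      rw [Finset.disjoint_left]
      intro q hq hq'
      simp only [Finset.mem_insert, Finset.mem_singleton] at hq hq'
      rcases hq with rfl | rfl <;> rcases hq' with h | h
      · exact hne (hinj (i := 0) (i' := 0) hp hp' (by omega) (by omega) h).1
      · exact hne (hinj (i := 0) (i' := 1) hp hp' (by omega) (by omega) h).1
      · exact hne (hinj (i := 1) (i' := 0) hp hp' (by omega) (by omega) h).1
      · exact hne (hinj (i := 1) (i' := 1) hp hp' (by omega) (by omega) h).1)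
    hP
  refine ⟨A, hA, fun z => ?_⟩
  rw [hAz]
  congr 1
  funext q
  by_cases hq : ∃ p < M, q = δ ((1 + 1) * p * s)
  · obtain ⟨p, hp, rfl⟩ := hq
    rw [blockSum_head hδ hs hN hp, Finset.sum_range_one, Bool.add_eq_xor]
    refine congrArg (xor _) ?_
    refine Bool.eq_iff_iff.2 (Iff.trans (@decide_eq_true_iff _ _) ?_)
    constructor
    · rintro ⟨p', hp', h, hall⟩
      obtain rfl := (hinj (i := 0) (i' := 0) (Finset.mem_range.1 hp') hp (by omega)
        (by omega) h).1
      refine hall _ (by simp) fun h' => ?_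
      have := (hinj (i := 1) (i' := 0) hp hp (by omega) (by omega) h').2
      omega
    · intro h
      refine ⟨p, Finset.mem_range.2 hp, rfl, fun q hq hne => ?_⟩
      rcases Finset.mem_insert.1 hq with rfl | hq
      · exact absurd rfl hne
      · rw [Finset.mem_singleton.1 hq]; exact h
  · have hq' : ¬∃ p ∈ Finset.range M, δ ((1 + 1) * p * s) = q ∧
        ∀ p' ∈ ({δ ((1 + 1) * p * s), δ (((1 + 1) * p + 1) * s)} : Finset _), p' ≠ q →
          z p' = true := by
      rintro ⟨p, hp, h, -⟩
      exact hq ⟨p, Finset.mem_range.1 hp, h.symm⟩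
    push Not at hq
    rw [blockSum_of_ne hq]
    exact (congrArg (xor (z q)) (@decide_eq_false _ _ hq')).trans (Bool.xor_false _)

end

theorem range_sum_eq_of_zero {n N : ℕ} (hn : n ≤ N) (g : ℕ → Bool)
    (hg : ∀ i, n ≤ i → i < N → g i = false) :
    ∑ i ∈ Finset.range N, g i = ∑ i : Fin n, g i := by
  rw [← Finset.sum_range fun i => g i]
  symm
  refine Finset.sum_subset (Finset.range_subset_range.2 hn) fun i hi hi' => ?_
  simp only [Finset.mem_range, not_lt] at hi hi'
  exact hg i hi' hi

/-- The placement of `n` input qubits at `δ 0, …, δ (n - 1)` and of the target at `δ N`. -/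
def treePlacement {n N : ℕ} (hn : n ≤ N) (δ : ℕ → Q)
    (hδ : ∀ i ≤ N, ∀ j ≤ N, δ i = δ j → i = j) : Fin (n + 1) ↪ Q :=
  ⟨fun i => if (i : ℕ) = n then δ N else δ i, fun i j h => by
    have hi := i.isLt
    have hj := j.isLt
    simp only at h
    split_ifs at h with h1 h2 h2
    · omega
    · have := hδ _ le_rfl _ (by omega) h; omega
    · have := hδ _ (by omega) _ le_rfl h; omega
    · have := hδ _ (by omega) _ (by omega) h; omega⟩

theorem treePlacement_apply {n N : ℕ} (hn : n ≤ N) (δ : ℕ → Q)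
    (hδ : ∀ i ≤ N, ∀ j ≤ N, δ i = δ j → i = j) (i : Fin (n + 1)) :
    treePlacement hn δ hδ i = if (i : ℕ) = n then δ N else δ i := rfl

theorem treePlacement_last {n N : ℕ} (hn : n ≤ N) (δ : ℕ → Q)
    (hδ : ∀ i ≤ N, ∀ j ≤ N, δ i = δ j → i = j) :
    treePlacement hn δ hδ (Fin.last n) = δ N := by
  simp [treePlacement_apply]

theorem treePlacement_castSucc {n N : ℕ} (hn : n ≤ N) (δ : ℕ → Q)
    (hδ : ∀ i ≤ N, ∀ j ≤ N, δ i = δ j → i = j) (i : Fin n) :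
    treePlacement hn δ hδ i.castSucc = δ i := by
  simp [treePlacement_apply, i.isLt.ne]

theorem sum_treePlacement {n N : ℕ} (hn : n ≤ N) (δ : ℕ → Q)
    (hδ : ∀ i ≤ N, ∀ j ≤ N, δ i = δ j → i = j) (z : Q → Bool)
    (hz : ∀ q, q ∉ Set.range (treePlacement hn δ hδ) → z q = false) :
    ∑ i ∈ Finset.range N, z (δ i) = ∑ i : Fin n, z (treePlacement hn δ hδ i.castSucc) := by
  simp only [treePlacement_castSucc]
  refine range_sum_eq_of_zero hn (fun i => z (δ i)) fun i hi hiN => hz _ ?_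
  rintro ⟨j, hj⟩
  have hjlt := j.isLt
  rw [treePlacement_apply] at hj
  split_ifs at hj with h
  · have := hδ _ le_rfl _ hiN.le hj; omega
  · have := hδ _ (by omega) _ hiN.le hj; omega

/-- The pairs span successive disjoint intervals, so a single track suffices. -/
theorem isRoutable_pairs {m M : ℕ} (a b : ℕ → Fin m) (hab : ∀ p < M, a p ≤ b p)
    (hba : ∀ p < M, ∀ p' < M, p < p' → b p < a p') :
    IsRoutable 1 ((Finset.range M).image fun p => ({a p, b p} : Finset (Fin m))) := by
  have h : ∀ S : Finset (Fin m), ∃ I : Fin m × Fin m,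
      S ∈ (Finset.range M).image (fun p => ({a p, b p} : Finset (Fin m))) →
        ∃ p < M, S = {a p, b p} ∧ I = (a p, b p) := by
    intro S
    by_cases hS : ∃ p < M, S = {a p, b p}
    · obtain ⟨p, hp, rfl⟩ := hS
      exact ⟨(a p, b p), fun _ => ⟨p, hp, rfl, rfl⟩⟩
    · by_cases hM : M = 0
      · by_cases hm : Nonempty (Fin m)
        · exact ⟨(hm.some, hm.some), by simp [hM]⟩
        · exact (hm ⟨a 0⟩).elim
      · refine ⟨(a 0, a 0), fun h => ?_⟩
        obtain ⟨p, hp, rfl⟩ := Finset.mem_image.1 h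
        exact absurd ⟨p, Finset.mem_range.1 hp, rfl⟩ hS
  choose I hI using h
  -- `I S` records the end points of the pair `S`; its value on other sets is irrelevant.
  refine ⟨fun _ => 0, fun S => (I S).1, fun S => (I S).2, fun S hS => ?_, fun S hS T hT hST _ => ?_⟩
  · obtain ⟨p, hp, rfl, h⟩ := hI S hS
    simp only [h]
    intro i hi
    rcases Finset.mem_insert.1 hi with rfl | hi
    · simp [hab p hp]
    · rw [Finset.mem_singleton.1 hi]; simp [hab p hp]
  · obtain ⟨p, hp, hSp, h⟩ := hI S hS
    obtain ⟨p', hp', hTp, h'⟩ := hI T hT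
    simp only [h, h', Finset.disjoint_left]
    intro i hi hi'
    rw [Finset.mem_Icc] at hi hi'
    rcases lt_trichotomy p p' with hlt | rfl | hlt
    · exact absurd (hba p hp p' hp' hlt) (not_lt.2 (hi'.1.trans hi.2))
    · exact hST (hSp.trans hTp.symm)
    · exact absurd (hba p' hp' p hp hlt) (not_lt.2 (hi.1.trans hi'.2))

/-- In the binary tree with its leaves in order on a row, the pairs of each level are successive
intervals. One routing row is enough, and the depth `2 * L + 1` of the tree is tripled by routing.
-/
theorem exists_circuit2D_width_two (n L : ℕ) (hn : n ≤ 2 ^ L) :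
    ∃ C : Circuit2D 2 (2 ^ L + 1), C.depth = 3 * (2 * L + 1) ∧
      C.Synthesizes (parityUnitary n) := by
  let δ : ℕ → Fin (2 ^ L + 1) := fun i => ⟨min i (2 ^ L), by omega⟩
  have hδ : ∀ i ≤ 2 ^ L, ∀ j ≤ 2 ^ L, δ i = δ j → i = j := by
    intro i hi j hj h
    simp only [δ, Fin.mk.injEq] at h
    omega
  have hle : ∀ {i j}, i ≤ j → δ i ≤ δ j := fun h => by
    simp only [δ, Fin.le_def]; omega
  have hlt : ∀ {i j}, i < j → j ≤ 2 ^ L → δ i < δ j := fun h hj => by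
    simp only [δ, Fin.lt_def]; omega
  obtain ⟨A, hA, hAz⟩ := exists_tree (P := IsRoutable 1) (k := 1) (L := L) (c := 1) (c₀ := 1)
    (anc := ∅) hδ (fun _ _ => Set.notMem_empty _)
    (fun s M hs hN => by
      obtain ⟨A, hA, hAz⟩ := Implements.blockSum_one (P := IsRoutable 1) hδ hs hN
        (isRoutable_pairs _ _ (fun p _ => hle (Nat.mul_le_mul_right _ (by omega)))
          (fun p _ p' hp' hpp' => hlt (Nat.mul_lt_mul_of_pos_right (by omega) hs)
            (block_index_lt (i := 0) hN hs hp' (Nat.zero_le _)).le))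
      exact ⟨A, hA, fun z _ => hAz z⟩)
    (by
      have := Implements.cnot (P := IsRoutable 1) (a := δ 0) (b := δ (2 ^ L))
        (hlt (by positivity) le_rfl).ne (by
          have := isRoutable_pairs (M := 1) (fun _ => δ 0) (fun _ => δ (2 ^ L))
            (fun _ _ => hle (Nat.zero_le _)) (by omega)
          simpa using this)
      simpa using this)
  have := exists_circuit2D_of_routable hA (treePlacement hn δ hδ) fun z hz => by
    rw [hAz z (by simp), treePlacement_last, ← sum_treePlacement hn δ hδ z hz]
  simpa using this

end Tree

/-! ### One operator acting in parallel on disjoint blocks -/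

section Blocks

variable {J G Q : Type} [Fintype J] [DecidableEq J] [Fintype G] [DecidableEq G] [Fintype Q]
  [DecidableEq Q]

/-- The operator that acts as `B` on each of the blocks of qubits `ι (j, ·)`, and as the identity on
the other qubits. -/
def blockOp (ι : J × G ↪ Q) (B : Operator G) : Operator Q :=
  Matrix.of fun x y => (if ∀ q, (∀ p, ι p ≠ q) → x q = y q then 1 else 0) *
    ∏ j, B (fun g => x (ι (j, g))) (fun g => y (ι (j, g)))

/-- The state with `f j` on the block `j`, and with `x` on the other qubits. -/
noncomputable def blockState (ι : J × G ↪ Q) (x : Q → Bool) (f : J → G → Bool) : Q → Bool :=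
  Function.extend ι (fun p => f p.1 p.2) x

theorem blockState_apply (ι : J × G ↪ Q) (x : Q → Bool) (f : J → G → Bool) (j : J) (g : G) :
    blockState ι x f (ι (j, g)) = f j g :=
  ι.injective.extend_apply _ _ _

theorem blockState_of_ne (ι : J × G ↪ Q) (x : Q → Bool) (f : J → G → Bool) {q : Q}
    (hq : ∀ p, ι p ≠ q) : blockState ι x f q = x q :=
  Function.extend_apply' _ _ _ fun ⟨p, hp⟩ => hq p hp

theorem eq_blockState {ι : J × G ↪ Q} {x w : Q → Bool} {f : J → G → Bool}
    (h : ∀ q, (∀ p, ι p ≠ q) → x q = w q) (hf : ∀ j g, w (ι (j, g)) = f j g) :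
    w = blockState ι x f := by
  funext q
  by_cases hq : ∀ p, ι p ≠ q
  · rw [blockState_of_ne ι x f hq, h q hq]
  · push Not at hq
    obtain ⟨⟨j, g⟩, rfl⟩ := hq
    rw [blockState_apply, hf]

theorem blockOp_mul (ι : J × G ↪ Q) (B B' : Operator G) :
    blockOp ι (B * B') = blockOp ι B * blockOp ι B' := by
  ext x y
  rw [mul_apply]
  -- Only intermediate states that agree with `x` off the blocks contribute, and these are
  -- parametrized by their restrictions `f` to the blocks.
  rw [← Fintype.sum_of_injective (blockState ι x)
    (f := fun f => blockOp ι B x (blockState ι x f) * blockOp ι B' (blockState ι x f) y)]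
  · simp only [blockOp, of_apply, mul_apply, Finset.prod_univ_sum, Fintype.piFinset_univ,
      Finset.mul_sum]
    refine Finset.sum_congr rfl fun f _ => ?_
    simp only [blockState_apply]
    have h1 : ∀ q, (∀ p, ι p ≠ q) → x q = blockState ι x f q :=
      fun q hq => (blockState_of_ne ι x f hq).symm
    have h2 : (∀ q, (∀ p, ι p ≠ q) → blockState ι x f q = y q) ↔
        ∀ q, (∀ p, ι p ≠ q) → x q = y q :=
      forall₂_congr fun q hq => by rw [blockState_of_ne ι x f hq]
    rw [if_pos h1, Finset.prod_mul_distrib]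
    simp only [h2]
    ring
  · intro f f' h
    funext j g
    rw [← blockState_apply ι x f, h, blockState_apply]
  · intro w hw
    rw [blockOp, of_apply, if_neg, zero_mul, zero_mul]
    intro h
    exact hw ⟨fun j g => w (ι (j, g)), (eq_blockState h fun _ _ => rfl).symm⟩
  · intro f
    rfl

theorem blockOp_mulVec_ket (ι : J × G ↪ Q) {B : Operator G} {z : Q → Bool} {f : J → G → Bool}
    (h : ∀ j, B *ᵥ ket (fun g => z (ι (j, g))) = ket (f j)) :
    blockOp ι B *ᵥ ket z = ket (blockState ι z f) := by
  have h' : ∀ j x, B x (fun g => z (ι (j, g))) = if x = f j then 1 else 0 := by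
    intro j x
    have := congrFun (h j) x
    rwa [mulVec_single_one, col_apply, ket_apply] at this
  ext x
  rw [mulVec_single_one, col_apply, ket_apply, blockOp, of_apply]
  simp only [h', Finset.prod_ite_zero, Finset.prod_const_one, Finset.mem_univ, true_imp_iff]
  by_cases hx : x = blockState ι z f
  · subst hx
    rw [if_pos fun q hq => blockState_of_ne ι z f hq,
      if_pos fun j => funext fun g => blockState_apply ι z f j g, if_pos rfl, one_mul]
  · rw [if_neg hx]
    by_cases h1 : ∀ q, (∀ p, ι p ≠ q) → x q = z q
    · rw [if_neg (c := ∀ j, (fun g => x (ι (j, g))) = f j), mul_zero]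
      intro h2
      exact hx (eq_blockState (fun q hq => (h1 q hq).symm) fun j g => congrFun (h2 j) g)
    · rw [if_neg h1, zero_mul]

theorem blockOp_tensorUnitary (ι : J × G ↪ Q) (u : G → unitaryGroup Bool ℂ) :
    blockOp ι (tensorUnitary u) =
      tensorUnitary (Function.extend ι (fun p => u p.2) 1) := by
  ext x y
  simp only [blockOp, tensorUnitary, of_apply]
  rw [← Finset.prod_compl_mul_prod (Finset.univ.map ι), Finset.prod_map,
    ← Finset.univ_product_univ, Finset.prod_product]
  congr 1
  · rw [Finset.prod_congr rfl (g := fun q => if x q = y q then (1 : ℂ) else 0)]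
    · rw [Finset.prod_ite_zero, Finset.prod_const_one]
      simp
    · intro q hq
      rw [Function.extend_apply' _ _ _ (by simpa using hq)]
      simp [one_apply]
  · refine Finset.prod_congr rfl fun j _ => Finset.prod_congr rfl fun g _ => ?_
    rw [ι.injective.extend_apply]

theorem blockOp_diagonal (ι : J × G ↪ Q) (φ : (G → Bool) → ℂ) :
    blockOp ι (diagonal φ) = diagonal fun x => ∏ j, φ fun g => x (ι (j, g)) := by
  ext x y
  simp only [blockOp, of_apply, diagonal_apply, Finset.prod_ite_zero, Finset.mem_univ,
    true_imp_iff]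
  by_cases hxy : x = y
  · subst hxy; simp
  · by_cases h1 : ∀ q, (∀ p, ι p ≠ q) → x q = y q
    · rw [if_neg hxy, if_neg (c := ∀ j, (fun g => x (ι (j, g))) = _), mul_zero]
      intro h2
      refine hxy (funext fun q => ?_)
      by_cases hq : ∀ p, ι p ≠ q
      · exact h1 q hq
      · push Not at hq
        obtain ⟨⟨j, g⟩, rfl⟩ := hq
        exact congrFun (h2 j) g
    · rw [if_neg h1, zero_mul, if_neg hxy]

/-- The copies on all blocks of the gates in `𝒢`. -/
def blockGates (ι : J × G ↪ Q) (𝒢 : Finset (Finset G)) : Finset (Finset Q) :=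
  (Finset.univ ×ˢ 𝒢).image fun s => s.2.map ⟨fun g => ι (s.1, g), fun g g' h => by
    simpa using ι.injective h⟩

theorem IsGateLayer.blockGates {𝒢 : Finset (Finset G)} (h : IsGateLayer 𝒢) (ι : J × G ↪ Q) :
    IsGateLayer (blockGates ι 𝒢) := by
  constructor
  · intro S hS
    obtain ⟨⟨j, S⟩, hs, rfl⟩ := Finset.mem_image.1 hS
    exact (h.1 S (Finset.mem_product.1 hs).2).map
  · intro S hS T hT hne
    obtain ⟨⟨j, S⟩, hs, rfl⟩ := Finset.mem_image.1 hS
    obtain ⟨⟨j', T⟩, ht, rfl⟩ := Finset.mem_image.1 hT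
    rw [Finset.disjoint_left]
    intro q hq hq'
    obtain ⟨g, hg, rfl⟩ := Finset.mem_map.1 hq
    obtain ⟨g', hg', hgg'⟩ := Finset.mem_map.1 hq'
    obtain ⟨rfl, rfl⟩ := Prod.mk.inj (ι.injective hgg')
    have : S ≠ T := fun h => hne (by rw [h])
    exact Finset.disjoint_left.1 (h.2 S (Finset.mem_product.1 hs).2 T
      (Finset.mem_product.1 ht).2 this) hg hg'

/-- Gates are nonempty, so copies on different blocks are different sets. Thus no factors are lost
when the product over blocks and gates is written over the finset of copies. -/
theorem blockOp_gatePhase {𝒢 : Finset (Finset G)} (h : IsGateLayer 𝒢) (ι : J × G ↪ Q) :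
    blockOp ι (diagonal (gatePhase 𝒢)) = diagonal (gatePhase (blockGates ι 𝒢)) := by
  rw [blockOp_diagonal]
  congr 1
  funext x
  simp only [gatePhase, blockGates]
  rw [Finset.prod_image, Finset.prod_product]
  · simp only [Finset.forall_mem_map]
    rfl
  · rintro ⟨j, S⟩ hs ⟨j', T⟩ ht hst
    have hS := (Finset.mem_product.1 hs).2
    simp only at hst
    obtain ⟨g, hg⟩ := h.1 S hS
    have hj : j = j' := by
      have := Finset.mem_map_of_mem ⟨fun g => ι (j, g), fun g g' h => by
        simpa using ι.injective h⟩ hg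
      rw [hst] at this
      obtain ⟨g', -, hgg'⟩ := Finset.mem_map.1 this
      exact (Prod.mk.inj (ι.injective hgg')).1.symm
    subst hj
    rw [Finset.map_inj.1 hst]

theorem Implements.blockOp {d : ℕ} {B : Operator G} (h : Implements (fun _ => True) d B)
    (ι : J × G ↪ Q) : Implements (fun _ => True) d (blockOp ι B) := by
  induction h with
  | tensor u => rw [blockOp_tensorUnitary]; exact .tensor _
  | layer u 𝒢 h𝒢 hP _ ih =>
    rw [blockOp_mul, blockOp_mul, blockOp_tensorUnitary, blockOp_gatePhase h𝒢]
    exact .layer _ _ (h𝒢.blockGates ι) trivial ih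

/-- On `m` tracks every layer of gates can be routed. -/
theorem Implements.isRoutable {m d : ℕ} [NeZero m] {A : Operator (Fin m)}
    (h : Implements (fun _ => True) d A) : Implements (IsRoutable m) d A := by
  induction h with
  | tensor u => exact .tensor u
  | layer u 𝒢 h𝒢 hP _ ih =>
    refine .layer u 𝒢 h𝒢 ?_ ih
    have : ∀ S : Finset (Fin m), ∃ a, S ∈ 𝒢 → a ∈ S := by
      intro S
      by_cases hS : S ∈ 𝒢
      · obtain ⟨a, ha⟩ := h𝒢.1 S hS
        exact ⟨a, fun _ => ha⟩
      · exact ⟨0, fun h => absurd h hS⟩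
    choose r hr using this
    -- Each gate gets the track numbered by one of its own qubits. Disjoint gates then have
    -- different tracks, and every gate may claim the whole row.
    refine ⟨r, fun _ => 0, fun _ => Fin.rev 0, fun S _ i _ => ?_, fun S hS T hT hST h => ?_⟩
    · rw [Finset.mem_Icc]
      refine ⟨Fin.zero_le _, Fin.le_def.2 ?_⟩
      simp only [Fin.val_rev]
      have := i.isLt
      simp
      omega
    · exact absurd (h ▸ hr T hT) (Finset.disjoint_left.1 (h𝒢.2 S hS T hT hST) (hr S hS))

end Blocks

/-! ### Exact amplitude amplification and the reflection test -/

section Amplification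

variable {α : Type} [Fintype α] [DecidableEq α]

/-- The reflection `1 - 2 |o⟩⟨o|`. -/
def reflection (o : α) : Matrix α α ℂ := diagonal fun y => if y = o then -1 else 1

theorem reflection_mulVec (o : α) (φ : α → ℂ) :
    reflection o *ᵥ φ = φ - (2 * φ o) • ket o := by
  ext y
  rw [reflection, mulVec_diagonal]
  by_cases hy : y = o
  · subst hy; simp; ring
  · simp [hy]

theorem reflection_mem_unitaryGroup (o : α) : reflection o ∈ unitaryGroup α ℂ := by
  rw [mem_unitaryGroup_iff, star_eq_conjTranspose, reflection, diagonal_conjTranspose,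
    diagonal_mul_diagonal, ← diagonal_one]
  congr 1
  funext y
  simp only [Pi.star_apply]
  split_ifs <;> simp

theorem diagonal_mem_unitaryGroup {k : α → ℂ} (hk : ∀ y, k y = 1 ∨ k y = -1) :
    diagonal k ∈ unitaryGroup α ℂ := by
  rw [mem_unitaryGroup_iff, star_eq_conjTranspose, diagonal_conjTranspose,
    diagonal_mul_diagonal, ← diagonal_one]
  congr 1
  funext y
  rcases hk y with h | h <;> simp [h]

/-- One round of amplitude amplification, for the state `A |o⟩` and the marked states with
`y = o` or `k y = -1`. -/
def amplify (o : α) (A : Matrix α α ℂ) (k : α → ℂ) : Matrix α α ℂ :=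
  A * reflection o * Aᴴ * (reflection o * diagonal k) * A

variable {o : α} {A : Matrix α α ℂ} {k : α → ℂ}

theorem amplify_mem_unitaryGroup (hA : A ∈ unitaryGroup α ℂ) (hk : ∀ y, k y = 1 ∨ k y = -1) :
    amplify o A k ∈ unitaryGroup α ℂ := by
  have hA' : Aᴴ ∈ unitaryGroup α ℂ := Unitary.star_mem hA
  exact mul_mem (mul_mem (mul_mem (mul_mem hA (reflection_mem_unitaryGroup o)) hA')
    (mul_mem (reflection_mem_unitaryGroup o) (diagonal_mem_unitaryGroup hk))) hA

/-- If the marked states have total weight `1 / 4`, then they are amplified to weight `1`. -/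
theorem amplify_mulVec_ket (hA : A ∈ unitaryGroup α ℂ) (ho : k o = 1)
    (hv0 : star (A o o) * A o o = 1 / 8) (hvk : ∑ y, k y * (star (A y o) * A y o) = 3 / 4) :
    amplify o A k *ᵥ ket o = fun y => ((if y = o then -1 else k y) - 1) * A y o := by
  have hAA : A * Aᴴ = 1 := (mem_unitaryGroup_iff).1 hA
  have hcol : A *ᵥ ket o = fun y => A y o := by
    ext y; rw [mulVec_single_one, col_apply]
  have hmark : (reflection o * diagonal k) *ᵥ (A *ᵥ ket o) =
      fun y => (if y = o then -1 else k y) * A y o := by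
    ext y
    rw [hcol, reflection, diagonal_mul_diagonal, mulVec_diagonal]
    by_cases hy : y = o
    · subst hy; simp [ho]
    · simp [hy]
  set u : α → ℂ := fun y => (if y = o then -1 else k y) * A y o with hu
  -- The value is `3 / 4 - 2 * (1 / 8)`. Being exactly `1 / 2`, it makes the second reflection
  -- subtract `A |o⟩` once, which cancels all unmarked components and multiplies the marked ones by
  -- `-2`.
  have hinner : (Aᴴ *ᵥ u) o = 1 / 2 := by
    have : (Aᴴ *ᵥ u) o = ∑ y, (k y * (star (A y o) * A y o) -
        if y = o then 2 * (star (A o o) * A o o) else 0) := by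
      simp only [mulVec, dotProduct, conjTranspose_apply, hu]
      refine Finset.sum_congr rfl fun y _ => ?_
      by_cases hy : y = o
      · subst hy; simp [ho]; ring
      · simp [hy]; ring
    rw [this, Finset.sum_sub_distrib, hvk, Finset.sum_ite_eq' Finset.univ o,
      if_pos (Finset.mem_univ _), hv0]
    norm_num
  rw [amplify, ← mulVec_mulVec, ← mulVec_mulVec, hmark, ← mulVec_mulVec, ← mulVec_mulVec,
    reflection_mulVec, hinner, mulVec_sub, mulVec_mulVec, hAA, one_mulVec, mulVec_smul, hcol]
  ext y
  simp only [hu, Pi.sub_apply, Pi.smul_apply, smul_eq_mul]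
  ring

/-- The reflection test: the state `|o⟩` is multiplied by `-1` if `b` is set and the diagonal sign
`δ` fixes the amplified state, i.e. if `δ o = 1`, and it is fixed if `δ o = -1`. -/
theorem signTest_mulVec_ket (hA : A ∈ unitaryGroup α ℂ) (hk : ∀ y, k y = 1 ∨ k y = -1)
    (ho : k o = 1) (hv0 : star (A o o) * A o o = 1 / 8)
    (hvk : ∑ y, k y * (star (A y o) * A y o) = 3 / 4) {δ : α → ℂ}
    (hδ : ∀ y, δ y = 1 ∨ δ y = -1) (hδk : ∀ y, k y = -1 → δ y = 1) (p b : Bool)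
    (hp : δ o = if p then 1 else -1) :
    ((amplify o A k)ᴴ * diagonal δ * amplify o A k * (if b then reflection o else 1) *
      ((amplify o A k)ᴴ * diagonal δ * amplify o A k)) *ᵥ ket o =
      (if b && p then (-1 : ℂ) else 1) • ket o := by
  have hC := amplify_mem_unitaryGroup (o := o) hA hk
  have hCo := amplify_mulVec_ket hA ho hv0 hvk
  set C := amplify o A k with hCdef
  have hCC : C * Cᴴ = 1 := (mem_unitaryGroup_iff).1 hC
  have hCC' : Cᴴ * C = 1 := (mem_unitaryGroup_iff').1 hC
  set W := Cᴴ * diagonal δ * C with hW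
  have hWW : W * W = 1 := by
    have hδδ : diagonal δ * diagonal δ = 1 := by
      rw [diagonal_mul_diagonal, ← diagonal_one]
      congr 1
      funext y
      rcases hδ y with h | h <;> simp [h]
    calc W * W = Cᴴ * (diagonal δ * (C * Cᴴ) * diagonal δ) * C := by
          simp only [hW, Matrix.mul_assoc]
      _ = 1 := by rw [hCC, Matrix.mul_one, hδδ, Matrix.mul_one, hCC']
  cases b with
  | false =>
    rw [if_neg (by simp), Matrix.mul_one, hWW, one_mulVec]
    simp
  | true =>
    rw [if_pos rfl, ← mulVec_mulVec, ← mulVec_mulVec, reflection_mulVec]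
    cases p with
    | true =>
      -- The amplified state lives on marked states, and there `δ` is `1`.
      have hWo : W *ᵥ ket o = ket o := by
        have : diagonal δ *ᵥ (C *ᵥ ket o) = C *ᵥ ket o := by
          ext y
          rw [mulVec_diagonal, hCo]
          by_cases hy : y = o
          · subst hy; simp [hp]
          · rcases hk y with h | h
            · simp [hy, h]
            · simp [hδk y h]
        rw [hW, ← mulVec_mulVec, ← mulVec_mulVec, this, mulVec_mulVec, hCC', one_mulVec]
      rw [hWo, mulVec_sub, mulVec_smul, hWo]
      ext y
      simp
      ring
    | false =>
      -- This is the expectation of `δ` in the amplified state: `2 - 2 * (3 / 4) - 4 * (1 / 8) = 0`.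
      -- The state `W |o⟩` is orthogonal to `|o⟩`, so the reflection does not affect it and the
      -- second `W` undoes the first.
      have hWo : (W *ᵥ ket o) o = 0 := by
        have hvv : ∑ y, star (A y o) * A y o = 1 := by
          have := congrFun (congrFun ((mem_unitaryGroup_iff').1 hA) o) o
          simpa [mul_apply, star_eq_conjTranspose] using this
        have : (W *ᵥ ket o) o = ∑ y, (2 * (star (A y o) * A y o) -
            2 * (k y * (star (A y o) * A y o)) -
            if y = o then 4 * (star (A o o) * A o o) else 0) := by
          rw [hW, ← mulVec_mulVec, ← mulVec_mulVec]
          have hCe : ∀ y, C y o = ((if y = o then -1 else k y) - 1) * A y o := fun y => by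
            rw [← congrFun hCo y, mulVec_single_one, col_apply]
          have : ∀ φ : α → ℂ, (Cᴴ *ᵥ φ) o = ∑ y, star (C y o) * φ y := fun φ => by
            simp [mulVec, dotProduct]
          rw [this]
          refine Finset.sum_congr rfl fun y _ => ?_
          rw [mulVec_diagonal, hCo, hCe]
          by_cases hy : y = o
          · subst hy; simp [hp, ho]; ring
          · rcases hk y with h | h
            · simp [hy, h]
            · simp [hy, h, hδk y h]; ring
        rw [this, Finset.sum_sub_distrib, Finset.sum_sub_distrib, ← Finset.mul_sum, hvv,
          ← Finset.mul_sum, hvk, Finset.sum_ite_eq' Finset.univ o, if_pos (Finset.mem_univ _), hv0]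
        norm_num
      rw [hWo, mul_zero, zero_smul, sub_zero, mulVec_mulVec, hWW, one_mulVec]
      simp

end Amplification

/-! ### Column states and the choice of their amplitude -/

section Preparation

/-- A rotation that maps `|1⟩` to `√t |0⟩ + √(1 - t) |1⟩`. -/
noncomputable def rotation (t : ℝ) (h0 : 0 ≤ t) (h1 : t ≤ 1) : unitaryGroup Bool ℂ :=
  ⟨Matrix.of fun x y => if x = y then ((Real.sqrt (1 - t) : ℝ) : ℂ) else
    if y then ((Real.sqrt t : ℝ) : ℂ) else -((Real.sqrt t : ℝ) : ℂ), by
    have h : ((Real.sqrt t : ℝ) : ℂ) * ((Real.sqrt t : ℝ) : ℂ) = t := by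
      rw [← Complex.ofReal_mul, Real.mul_self_sqrt h0]
    have h' : ((Real.sqrt (1 - t) : ℝ) : ℂ) * ((Real.sqrt (1 - t) : ℝ) : ℂ) = 1 - t := by
      rw [← Complex.ofReal_mul, Real.mul_self_sqrt (by linarith)]; simp
    rw [mem_unitaryGroup_iff]
    ext x y
    cases x <;> cases y <;> simp [mul_apply, star_eq_conjTranspose, h, h'] <;> ring⟩

variable {t : ℝ} {h0 : 0 ≤ t} {h1 : t ≤ 1} {k : ℕ}

theorem rotation_apply_false_false :
    (rotation t h0 h1 : Matrix Bool Bool ℂ) false false = ((Real.sqrt (1 - t) : ℝ) : ℂ) := by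
  simp [rotation]

theorem rotation_apply_true_true :
    (rotation t h0 h1 : Matrix Bool Bool ℂ) true true = ((Real.sqrt (1 - t) : ℝ) : ℂ) := by
  simp [rotation]

theorem rotation_apply_false_true :
    (rotation t h0 h1 : Matrix Bool Bool ℂ) false true = ((Real.sqrt t : ℝ) : ℂ) := by
  simp [rotation]

/-- The reflection of `k` qubits in the product state `(√t |0⟩ + √(1 - t) |1⟩) ^ ⊗k`. -/
noncomputable def productReflection (k : ℕ) (t : ℝ) (h0 : 0 ≤ t) (h1 : t ≤ 1) :
    Operator (Fin k) :=
  tensorUnitary (fun _ => rotation t h0 h1) * diagonal (gatePhase {Finset.univ}) *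
    tensorUnitary (star fun _ => rotation t h0 h1)

theorem gatePhase_univ {Q : Type} [Fintype Q] [DecidableEq Q] :
    (diagonal (gatePhase {Finset.univ}) : Operator Q) = reflection fun _ => true := by
  rw [reflection]
  congr 1
  funext y
  simp [gatePhase, funext_iff]

theorem isGateLayer_singleton {Q : Type} [Fintype Q] [DecidableEq Q] {S : Finset Q}
    (hS : S.Nonempty) : IsGateLayer {S} := by
  simp [IsGateLayer, hS]

theorem implements_productReflection [NeZero k] :
    Implements (fun _ => True) 1 (productReflection k t h0 h1) := by
  rw [productReflection, Matrix.mul_assoc]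
  exact (((Implements.phase (isGateLayer_singleton Finset.univ_nonempty) trivial).mul
    (.tensor _)).tensor_mul _).congr_depth (by simp)

theorem productReflection_mem_unitaryGroup :
    productReflection k t h0 h1 ∈ unitaryGroup (Fin k → Bool) ℂ := by
  rw [productReflection, gatePhase_univ]
  exact mul_mem (mul_mem (tensorUnitary_mem_unitaryGroup _) (reflection_mem_unitaryGroup _))
    (tensorUnitary_mem_unitaryGroup _)

theorem productReflection_conjTranspose :
    (productReflection k t h0 h1)ᴴ = productReflection k t h0 h1 := by
  have : (reflection fun _ : Fin k => true)ᴴ = reflection fun _ => true := by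
    rw [reflection, diagonal_conjTranspose]
    congr 1
    funext y
    simp only [Pi.star_apply]
    split_ifs <;> simp
  rw [productReflection, gatePhase_univ, conjTranspose_mul, conjTranspose_mul, tensorUnitary_star,
    tensorUnitary_star, star_star, this, Matrix.mul_assoc]

theorem productReflection_apply (y : Fin k → Bool) :
    productReflection k t h0 h1 y (fun _ => false) = (if y = fun _ => false then 1 else 0) -
      2 * (∏ i, (rotation t h0 h1 : Matrix Bool Bool ℂ) (y i) true) *
        ((Real.sqrt t : ℝ) : ℂ) ^ k := by
  have key : productReflection k t h0 h1 *ᵥ ket (fun _ => false) = ket (fun _ => false) -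
      (2 * ((Real.sqrt t : ℝ) : ℂ) ^ k) •
        (tensorUnitary (fun _ => rotation t h0 h1) *ᵥ ket fun _ => true) := by
    have hstar : (fun _ : Fin k => rotation t h0 h1) * star (fun _ => rotation t h0 h1) = 1 :=
      funext fun _ => Unitary.mul_star_self _
    rw [productReflection, gatePhase_univ, ← mulVec_mulVec, ← mulVec_mulVec, reflection_mulVec,
      mulVec_sub, mulVec_smul, mulVec_mulVec, tensorUnitary_mul, hstar,
      tensorUnitary_one, one_mulVec]
    congr 3
    rw [tensorUnitary_mulVec_ket]
    simp [rotation_apply_false_true]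
  have := congrFun key y
  rw [mulVec_single_one, col_apply] at this
  rw [this, Pi.sub_apply, Pi.smul_apply, tensorUnitary_mulVec_ket, ket_apply, smul_eq_mul]
  ring

theorem productReflection_zero :
    productReflection k t h0 h1 (fun _ => false) (fun _ => false) = ((1 - 2 * t ^ k : ℝ) : ℂ) := by
  have : ((Real.sqrt t : ℝ) : ℂ) ^ k * ((Real.sqrt t : ℝ) : ℂ) ^ k = (t : ℂ) ^ k := by
    rw [← mul_pow, ← Complex.ofReal_mul, Real.mul_self_sqrt h0]
  rw [productReflection_apply, if_pos rfl]
  simp only [rotation_apply_false_true, Finset.prod_const, Finset.card_univ, Fintype.card_fin]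
  rw [mul_assoc, this]
  push_cast
  ring

/-- The gate negates only `|1 ^ k⟩`, so the sum is one minus twice the weight of that state, which
is `4 * (t * (1 - t)) ^ k`. -/
theorem sum_productReflection [NeZero k] :
    ∑ y, gatePhase {Finset.univ} y * (star (productReflection k t h0 h1 y fun _ => false) *
      productReflection k t h0 h1 y fun _ => false) = ((1 - 8 * (t * (1 - t)) ^ k : ℝ) : ℂ) := by
  have h2 : ∑ y, star (productReflection k t h0 h1 y fun _ => false) *
      productReflection k t h0 h1 y (fun _ => false) = 1 := by
    have := congrFun (congrFun ((mem_unitaryGroup_iff').1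
      (productReflection_mem_unitaryGroup (k := k) (h0 := h0) (h1 := h1))) fun _ => false)
      fun _ => false
    simpa [mul_apply, star_eq_conjTranspose] using this
  have hone : star (productReflection k t h0 h1 (fun _ => true) fun _ => false) *
      productReflection k t h0 h1 (fun _ => true) (fun _ => false) =
        ((4 * (t * (1 - t)) ^ k : ℝ) : ℂ) := by
    have hne : (fun _ : Fin k => true) ≠ fun _ => false := fun h => by
      simpa using congrFun h 0
    rw [productReflection_apply, if_neg hne]
    simp only [rotation_apply_true_true, Finset.prod_const, Finset.card_univ, Fintype.card_fin]
    rw [← Complex.ofReal_pow, ← Complex.ofReal_pow]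
    have e1 : Real.sqrt t ^ k * Real.sqrt t ^ k = t ^ k := by
      rw [← mul_pow, Real.mul_self_sqrt h0]
    have e2 : Real.sqrt (1 - t) ^ k * Real.sqrt (1 - t) ^ k = (1 - t) ^ k := by
      rw [← mul_pow, Real.mul_self_sqrt (by linarith)]
    simp only [zero_sub, star_neg, star_mul', RCLike.star_def, Complex.conj_ofReal, map_ofNat]
    norm_cast
    rw [mul_pow, ← e1, ← e2]
    ring
  rw [show ((1 - 8 * (t * (1 - t)) ^ k : ℝ) : ℂ) = 1 - 2 * ((4 * (t * (1 - t)) ^ k : ℝ) : ℂ) by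
    push_cast; ring, ← hone, ← h2]
  rw [← Finset.sum_ite_eq' Finset.univ (fun _ : Fin k => true) (fun y =>
    star (productReflection k t h0 h1 y fun _ => false) *
      productReflection k t h0 h1 y (fun _ => false)) |>.trans (if_pos (Finset.mem_univ _)),
    Finset.mul_sum, ← Finset.sum_sub_distrib]
  refine Finset.sum_congr rfl fun y _ => ?_
  simp only [gatePhase, Finset.prod_singleton, Finset.mem_univ, true_imp_iff, funext_iff]
  split_ifs <;> ring

/-- The choice of the amplitude `t`. -/
theorem exists_amplitude (k N : ℕ) (hk : 1 ≤ k) (hN : N = (8 * k) ^ k) :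
    ∃ t : ℝ, 0 ≤ t ∧ t ≤ 1 ∧ (1 - 8 * (t * (1 - t)) ^ k) ^ N = 3 / 4 ∧
      3 / 4 ≤ ((1 - 2 * t ^ k) ^ N) ^ 2 := by
  have hk' : (1 : ℝ) ≤ k := by exact_mod_cast hk
  -- This bound gives `N * t₁ ^ k = 1`, and by Bernoulli `(1 - t) ^ k ≥ 7 / 8` for all `t ≤ t₁`. The
  -- exact value `3 / 4` is then attained in `[0, t₁]` by the intermediate value theorem.
  set t₁ : ℝ := 1 / (8 * k) with ht₁
  have ht₁0 : 0 < t₁ := by positivity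
  have ht₁le : k * t₁ = 1 / 8 := by rw [ht₁]; field_simp
  have ht₁1 : t₁ ≤ 1 / 8 := by nlinarith
  have hbern : ∀ t : ℝ, 0 ≤ t → t ≤ t₁ → 7 / 8 ≤ (1 - t) ^ k := by
    intro t h0 h1
    have := one_add_mul_le_pow (a := -t) (by linarith) k
    have h2 : (k : ℝ) * t ≤ k * t₁ := by gcongr
    calc (7 : ℝ) / 8 ≤ 1 + k * -t := by linarith
      _ ≤ (1 + -t) ^ k := this
      _ = (1 - t) ^ k := by ring_nf
  have hpow : ∀ t : ℝ, 0 ≤ t → t ≤ t₁ → t ^ k ≤ 1 / 8 := by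
    intro t h0 h1
    calc t ^ k ≤ t ^ 1 := pow_le_pow_of_le_one h0 (by linarith) hk
      _ ≤ 1 / 8 := by linarith
  have hx0 : ∀ t : ℝ, 0 ≤ t → t ≤ t₁ → 0 ≤ 1 - 8 * (t * (1 - t)) ^ k := by
    intro t h0 h1
    have h3 : (1 - t) ^ k ≤ 1 := pow_le_one₀ (by linarith) (by linarith)
    have h4 := hpow t h0 h1
    have h5 : 0 ≤ t ^ k := by positivity
    rw [mul_pow]
    nlinarith
  have hcont : ContinuousOn (fun t : ℝ => (1 - 8 * (t * (1 - t)) ^ k) ^ N) (Set.Icc 0 t₁) := by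
    fun_prop
  have hstart : (1 - 8 * ((0 : ℝ) * (1 - 0)) ^ k) ^ N = 1 := by
    simp [show k ≠ 0 by omega]
  -- From `(1 - x) ^ N * (1 + x) ^ N ≤ 1` and Bernoulli, `(1 - x) ^ N ≤ 1 / (1 + N * x)`, so `N * x
  -- ≥ 1 / 3` suffices.
  have hend : (1 - 8 * (t₁ * (1 - t₁)) ^ k) ^ N ≤ 3 / 4 := by
    set x := 8 * (t₁ * (1 - t₁)) ^ k with hx
    have hNx : 1 / 3 ≤ N * x := by
      have hNt : (N : ℝ) * t₁ ^ k = 1 := by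
        rw [hN, ht₁]; push_cast; rw [← mul_pow]; field_simp; simp
      rw [hx, mul_pow]
      have := hbern t₁ ht₁0.le le_rfl
      calc (1 : ℝ) / 3 ≤ 8 * (1 - t₁) ^ k := by linarith
        _ = 8 * (N * t₁ ^ k) * (1 - t₁) ^ k := by rw [hNt]; ring
        _ = N * (8 * (t₁ ^ k * (1 - t₁) ^ k)) := by ring
    have hx1 : 0 ≤ 1 - x := hx0 t₁ ht₁0.le le_rfl
    have hxpos : 0 ≤ x := by
      have : 0 ≤ 1 - t₁ := by linarith
      positivity
    have h1 := one_add_mul_le_pow (a := x) (by linarith) N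
    have h2 : (1 - x) ^ N * (1 + x) ^ N ≤ 1 := by
      rw [← mul_pow]
      exact pow_le_one₀ (by nlinarith) (by nlinarith)
    have h3 : 0 ≤ (1 - x) ^ N := by positivity
    nlinarith
  obtain ⟨t, ht, hteq⟩ := intermediate_value_Icc' ht₁0.le hcont
    (show (3 / 4 : ℝ) ∈ Set.Icc _ _ from ⟨hend, by simp only [hstart]; norm_num⟩)
  refine ⟨t, ht.1, by linarith [ht.2], hteq, ?_⟩
  simp only at hteq
  -- Compare bases: `(1 - 2 * t ^ k) ^ 2 ≥ 1 - 4 * t ^ k ≥ 1 - 8 * (t * (1 - t)) ^ k`, as `(1 - t) ^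
  -- k ≥ 1 / 2`.
  rw [← hteq, ← pow_mul, mul_comm N 2, pow_mul]
  refine pow_le_pow_left₀ (hx0 t ht.1 ht.2) ?_ N
  have h3 := hbern t ht.1 ht.2
  have h5 : 0 ≤ t ^ k := pow_nonneg ht.1 k
  rw [mul_pow]
  nlinarith [mul_nonneg h5 h5, mul_le_mul_of_nonneg_left h3 h5]

end Preparation

/-! ### Preparation of the ancilla register -/

section Gadget

theorem blockOp_one {J G Q : Type} [Fintype J] [DecidableEq J] [Fintype G] [DecidableEq G]
    [Fintype Q] [DecidableEq Q] (ι : J × G ↪ Q) : blockOp ι (1 : Operator G) = 1 := by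
  rw [← diagonal_one, blockOp_diagonal, ← diagonal_one]
  simp

theorem blockOp_conjTranspose {J G Q : Type} [Fintype J] [DecidableEq J] [Fintype G]
    [DecidableEq G] [Fintype Q] [DecidableEq Q] (ι : J × G ↪ Q) (B : Operator G) :
    (blockOp ι B)ᴴ = blockOp ι Bᴴ := by
  ext x y
  simp only [blockOp, conjTranspose_apply, of_apply, star_mul', star_prod]
  congr 1
  simp only [eq_comm (a := x _)]
  split_ifs <;> simp

/-- The ancilla register of the parity gadget: `N` columns of `k` qubits and one more qubit. -/
abbrev Register (N k : ℕ) : Type := Option (Fin N × Fin k)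

variable {N k : ℕ}

/-- The sign `(-1) ^ r`, where `r` is the number of columns with all bits equal to one. -/
def columnSign (y : Register N k → Bool) : ℂ :=
  ∏ c : Fin N, if ∀ i, y (some (c, i)) = true then -1 else 1

theorem diagonal_columnSign :
    diagonal (columnSign : (Register N k → Bool) → ℂ) =
      blockOp Function.Embedding.some (diagonal (gatePhase {Finset.univ})) := by
  rw [blockOp_diagonal]
  simp [gatePhase, columnSign]

theorem implements_columnSign [NeZero k] :
    Implements (fun _ => True) 1 (diagonal (columnSign : (Register N k → Bool) → ℂ)) := by
  rw [diagonal_columnSign]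
  exact (Implements.phase (isGateLayer_singleton Finset.univ_nonempty) trivial).blockOp _

theorem columnSign_eq_or (y : Register N k → Bool) : columnSign y = 1 ∨ columnSign y = -1 := by
  refine Finset.prod_induction _ (fun x : ℂ => x = 1 ∨ x = -1) ?_ (Or.inl rfl) ?_
  · rintro a b (rfl | rfl) (rfl | rfl) <;> simp
  · intro c _
    split_ifs <;> simp

theorem columnSign_zero [NeZero k] : columnSign (fun _ : Register N k => false) = 1 := by
  simp only [columnSign]
  refine Finset.prod_eq_one fun c _ => if_neg fun h => by simpa using h 0

theorem exists_column_of_columnSign {y : Register N k → Bool} (h : columnSign y = -1) :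
    ∃ c : Fin N, ∀ i, y (some (c, i)) = true := by
  by_contra hc
  rw [columnSign, Finset.prod_eq_one fun c _ => if_neg fun h' => hc ⟨c, h'⟩] at h
  norm_num at h

/-- The states of the register as pairs of a bit and a family of column states. -/
def registerEquiv (N k : ℕ) :
    (Bool × (Fin N → Fin k → Bool)) ≃ (Register N k → Bool) where
  toFun p q := q.elim p.1 fun ci => p.2 ci.1 ci.2
  invFun y := (y none, fun c i => y (some (c, i)))
  left_inv _ := rfl
  right_inv y := by funext q; cases q <;> rfl

/-- The columns are independent, so the expectation of `columnSign` is the `N`-th power of that of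
one column, which `exists_amplitude` makes `3 / 4`: the weight of an odd number of all-one columns
is `1 / 8`. The columns are jointly zero with weight `p ≥ 3 / 4`; the extra qubit, which
`columnSign` ignores, lowers the weight of the zero state to exactly `1 / 8`. -/
theorem exists_preparation [NeZero k] (hN : N = (8 * k) ^ k) :
    ∃ A : Operator (Register N k), Implements (fun _ => True) 1 A ∧
      Implements (fun _ => True) 1 Aᴴ ∧ A ∈ unitaryGroup (Register N k → Bool) ℂ ∧
      star (A (fun _ => false) fun _ => false) * A (fun _ => false) (fun _ => false) = 1 / 8 ∧
      ∑ y, columnSign y * (star (A y fun _ => false) * A y fun _ => false) = 3 / 4 := by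
  obtain ⟨t, h0, h1, ht, hp⟩ := exists_amplitude k N (NeZero.one_le) hN
  set p : ℝ := ((1 - 2 * t ^ k) ^ N) ^ 2 with hpdef
  have hp0 : 0 < p := by linarith
  have hs1 : 1 / (8 * p) ≤ 1 := by
    rw [div_le_one (by positivity)]; linarith
  have hs0 : 0 ≤ 1 / (8 * p) := by positivity
  set B := productReflection k t h0 h1 with hB
  -- This rotation leaves `|0⟩` with weight `1 / (8 * p)`, so that the zero state gets `p * (1 / (8
  -- * p))`.
  set r := rotation (1 - 1 / (8 * p)) (by linarith) (by linarith) with hr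
  set u : Register N k → unitaryGroup Bool ℂ := fun q => if q = none then r else 1 with hu
  set ι : Fin N × Fin k ↪ Register N k := Function.Embedding.some with hι
  have hBimp : Implements (fun _ => True) 1 (blockOp ι B) := implements_productReflection.blockOp ι
  have hBstar : (blockOp ι B)ᴴ = blockOp ι B := by
    rw [blockOp_conjTranspose, hB, productReflection_conjTranspose]
  have hA : ∀ y, (blockOp ι B * tensorUnitary u) y (fun _ => false) =
      (r : Matrix Bool Bool ℂ) (y none) false * ∏ c, B (fun i => y (some (c, i))) fun _ => false := by
    intro y
    rw [mul_apply, Finset.sum_eq_single (fun q => q.elim (y none) fun _ => false)]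
    · rw [blockOp, of_apply, if_pos, one_mul, mul_comm]
      · congr 1
        simp only [tensorUnitary, of_apply, Fintype.prod_option, hu, if_true, reduceCtorEq, if_false]
        refine (congrArg _ (Finset.prod_eq_one fun s _ => ?_)).trans (mul_one _)
        exact one_apply_eq _
      · intro q hq
        cases q with
        | none => rfl
        | some s => exact absurd rfl (hq s)
    · intro w _ hw
      by_cases h : ∀ s, w (some s) = false
      · have hne : y none ≠ w none := by
          intro hyw
          refine hw (funext fun q => ?_)
          cases q with
          | none => exact hyw.symm
          | some s => exact h s
        rw [blockOp, of_apply, if_neg, zero_mul, zero_mul]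
        intro h'
        exact hne (h' none fun s => by simp [hι])
      · push Not at h
        obtain ⟨s, hs⟩ := h
        have : tensorUnitary u w (fun _ => false) = 0 := by
          rw [tensorUnitary, of_apply]
          refine Finset.prod_eq_zero (Finset.mem_univ (some s)) ?_
          simp [hu, hs]
        rw [this, mul_zero]
    · simp
  refine ⟨blockOp ι B * tensorUnitary u, ?_, ?_, ?_, ?_, ?_⟩
  · exact (hBimp.mul (.tensor u)).congr_depth (by simp)
  · rw [conjTranspose_mul, hBstar, tensorUnitary_star]
    exact hBimp.tensor_mul _
  · refine mul_mem ?_ (tensorUnitary_mem_unitaryGroup u)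
    rw [mem_unitaryGroup_iff, star_eq_conjTranspose, hBstar, ← blockOp_mul]
    have := (mem_unitaryGroup_iff).1
      (productReflection_mem_unitaryGroup (k := k) (h0 := h0) (h1 := h1))
    rw [star_eq_conjTranspose, productReflection_conjTranspose] at this
    rw [hB, this, blockOp_one]
  · rw [hA, hr, rotation_apply_false_false, hB, productReflection_zero]
    simp only [Finset.prod_const, Finset.card_univ, Fintype.card_fin, star_mul', star_pow,
      RCLike.star_def, Complex.conj_ofReal, sub_sub_cancel]
    have e1 : Real.sqrt (1 / (8 * p)) * Real.sqrt (1 / (8 * p)) = 1 / (8 * p) :=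
      Real.mul_self_sqrt hs0
    have e2 : Real.sqrt (1 / (8 * p)) * (1 - 2 * t ^ k) ^ N *
        (Real.sqrt (1 / (8 * p)) * (1 - 2 * t ^ k) ^ N) = 1 / 8 := by
      calc _ = (Real.sqrt (1 / (8 * p)) * Real.sqrt (1 / (8 * p))) * p := by rw [hpdef]; ring
        _ = 1 / 8 := by rw [e1]; field_simp
    have e3 := congrArg Complex.ofReal e2
    simp only [Complex.ofReal_mul, Complex.ofReal_pow] at e3
    rw [e3]
    norm_num
  · have hrr : ∑ b, star ((r : Matrix Bool Bool ℂ) b false) * (r : Matrix Bool Bool ℂ) b false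
        = 1 := by
      have := congrFun (congrFun ((mem_unitaryGroup_iff').1 r.2) false) false
      simpa [mul_apply, star_eq_conjTranspose] using this
    have hBB := sum_productReflection (k := k) (t := t) (h0 := h0) (h1 := h1)
    rw [← (registerEquiv N k).sum_comp, Fintype.sum_prod_type]
    have hterm : ∀ (b : Bool) (f : Fin N → Fin k → Bool),
        columnSign (registerEquiv N k (b, f)) *
          (star ((blockOp ι B * tensorUnitary u) (registerEquiv N k (b, f)) fun _ => false) *
            (blockOp ι B * tensorUnitary u) (registerEquiv N k (b, f)) fun _ => false) =
        (star ((r : Matrix Bool Bool ℂ) b false) * (r : Matrix Bool Bool ℂ) b false) *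
          ∏ c, gatePhase {Finset.univ} (f c) *
            (star (B (f c) fun _ => false) * B (f c) fun _ => false) := by
      intro b f
      rw [hA, star_mul', star_prod, Finset.prod_mul_distrib, Finset.prod_mul_distrib]
      have : columnSign (registerEquiv N k (b, f)) = ∏ c, gatePhase {Finset.univ} (f c) := by
        simp only [columnSign, gatePhase, Finset.prod_singleton, Finset.mem_univ, true_imp_iff]
        rfl
      rw [this]
      simp only [registerEquiv, Equiv.coe_fn_mk, Option.elim]
      ring
    simp only [hterm]
    simp only [← Finset.mul_sum]
    have hprod : ∀ g : (Fin k → Bool) → ℂ,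
        ∑ f : Fin N → Fin k → Bool, ∏ c, g (f c) = ∏ _c : Fin N, ∑ y, g y := fun g => by
      rw [Finset.prod_univ_sum, Fintype.piFinset_univ]
    rw [← Finset.sum_mul, hrr, one_mul]
    refine (hprod fun y => gatePhase {Finset.univ} y *
      (star (B y fun _ => false) * B y fun _ => false)).trans ?_
    rw [hB, Finset.prod_const, hBB, Finset.card_univ, Fintype.card_fin, ← Complex.ofReal_pow, ht]
    norm_num

end Gadget

/-! ### Parity of `k` bits in constant depth -/

section Gadget

section Spectators

variable {D R : Type} [Fintype D] [DecidableEq D] [Fintype R] [DecidableEq R]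

/-- The qubits `R` as the only block of `D ⊕ R`. -/
def rightBlock (D R : Type) : Unit × R ↪ D ⊕ R :=
  ⟨fun p => Sum.inr p.2, fun _ _ h => Prod.ext rfl (Sum.inr.inj h)⟩

theorem sumElim_injective (a : D → Bool) :
    Function.Injective (Sum.elim a : (R → Bool) → D ⊕ R → Bool) :=
  fun _ _ h => funext fun r => congrFun h (Sum.inr r)

/-- While the data bits have fixed values `a`, the gadget acts on the register alone. This reduces
its analysis to `signTest_mulVec_ket`. -/
theorem intertwines_blockOp (a : D → Bool) (B : Operator R) :
    Intertwines (Sum.elim a : (R → Bool) → D ⊕ R → Bool) (blockOp (rightBlock D R) B) B := by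
  refine .of_ket fun z => ?_
  ext y
  rw [mulVec_single_one, col_apply, blockOp, of_apply]
  by_cases h : ∃ x, y = Sum.elim a x
  · obtain ⟨x, rfl⟩ := h
    rw [basisMap_mulVec_apply (sumElim_injective a), mulVec_single_one, col_apply, if_pos]
    · simp only [Finset.univ_unique, Finset.prod_singleton, one_mul]
      rfl
    · rintro (q | q) hq
      · rfl
      · exact absurd rfl (hq ((), q))
  · rw [basisMap_mulVec_apply_of_notMem _ fun x hx => h ⟨x, hx⟩, if_neg, zero_mul]
    intro h'
    refine h ⟨fun r => y (Sum.inr r), funext fun q => ?_⟩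
    cases q with
    | inl q => exact h' (Sum.inl q) fun p hp => Sum.inr_ne_inl hp
    | inr q => rfl

theorem intertwines_diagonal (a : D → Bool) (φ : (D ⊕ R → Bool) → ℂ) :
    Intertwines (Sum.elim a : (R → Bool) → D ⊕ R → Bool) (diagonal φ)
      (diagonal fun r => φ (Sum.elim a r)) := by
  refine .of_ket fun z => ?_
  rw [diagonal_mulVec_ket, diagonal_mulVec_ket, mulVec_smul, basisMap_mulVec_ket]

end Spectators

variable {N k : ℕ}

/-- The qubits of the parity gadget: the target `none`, the inputs `some i` and the register. -/
abbrev GadgetQubits (N k : ℕ) : Type := Option (Fin k) ⊕ Register N k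

/-- The sign of the layer that tests, for each input qubit that is set, whether the corresponding row
of the register is zero. -/
def rowSign (w : GadgetQubits N k → Bool) : ℂ :=
  ∏ i : Fin k, if w (Sum.inl (some i)) = true ∧ ∀ c, w (Sum.inr (some (c, i))) = false then -1 else 1

theorem implements_rowSign :
    Implements (fun _ => True) 1 (diagonal (rowSign : (GadgetQubits N k → Bool) → ℂ)) := by
  let S : Fin k → Finset (GadgetQubits N k) := fun i =>
    insert (Sum.inl (some i)) (Finset.univ.image fun c => Sum.inr (some (c, i)))
  have hdis : ∀ i j, i ≠ j → Disjoint (S i) (S j) := by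
    intro i j hij
    rw [Finset.disjoint_left]
    intro q hq hq'
    simp only [S, Finset.mem_insert, Finset.mem_image, Finset.mem_univ, true_and] at hq hq'
    rcases hq with rfl | ⟨c, rfl⟩ <;> rcases hq' with h | ⟨c', h⟩ <;> simp at h
    · exact hij h
    · exact hij h.2.symm
  have hmem : ∀ i, Sum.inl (some i) ∈ S i := fun i => Finset.mem_insert_self _ _
  have hinj : Function.Injective S := by
    intro i j h
    by_contra hij
    have := hdis i j hij
    rw [← h, disjoint_self] at this
    exact Finset.Nonempty.ne_empty ⟨_, hmem i⟩ this
  have h𝒢 : IsGateLayer (Finset.univ.image S) := by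
    constructor
    · intro T hT
      obtain ⟨i, -, rfl⟩ := Finset.mem_image.1 hT
      exact ⟨_, hmem i⟩
    · intro T hT T' hT' hne
      obtain ⟨i, -, rfl⟩ := Finset.mem_image.1 hT
      obtain ⟨j, -, rfl⟩ := Finset.mem_image.1 hT'
      exact hdis i j fun h => hne (h ▸ rfl)
  convert Implements.flip_phase (P := fun _ => True) h𝒢 trivial
    (Sum.elim (fun _ => false) fun _ => true) using 3 with w
  rw [gatePhase, Finset.prod_image fun i _ j _ h => hinj h, rowSign]
  refine Finset.prod_congr rfl fun i _ => ?_
  simp [S]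

/-- The sign of the gate that tests whether the target is set and the register is zero. -/
def registerSign (w : GadgetQubits N k → Bool) : ℂ :=
  if w (Sum.inl none) = true ∧ ∀ r, w (Sum.inr r) = false then -1 else 1

theorem implements_registerSign :
    Implements (fun _ => True) 1 (diagonal (registerSign : (GadgetQubits N k → Bool) → ℂ)) := by
  convert Implements.flip_phase (P := fun _ => True)
    (isGateLayer_singleton (S := insert (Sum.inl none)
      (Finset.univ.image (Sum.inr : Register N k → GadgetQubits N k)))
      (Finset.insert_nonempty _ _)) trivial
    (Sum.elim (fun _ => false) fun _ => true) using 3 with w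
  rw [gatePhase, Finset.prod_singleton, registerSign]
  congr 1
  simp

theorem implements_reflection_zero :
    Implements (fun _ => True) 1 (reflection fun _ : Register N k => false) := by
  convert Implements.flip_phase (P := fun _ => True)
    (isGateLayer_singleton (S := (Finset.univ : Finset (Register N k))) Finset.univ_nonempty)
    trivial (fun _ => true) using 1
  rw [reflection]
  congr 1
  funext y
  rw [gatePhase, Finset.prod_singleton]
  simp [funext_iff]

theorem rowSign_zero (a : Option (Fin k) → Bool) :
    rowSign (Sum.elim a fun _ : Register N k => false) =
      if !(∑ i, a (some i)) then 1 else -1 := by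
  have key : ∀ s : Finset (Fin k), (∏ i ∈ s, if a (some i) = true then (-1 : ℂ) else 1) =
      if !(∑ i ∈ s, a (some i)) then 1 else -1 := by
    intro s
    induction s using Finset.induction_on with
    | empty => simp
    | insert i s hi ih =>
      rw [Finset.prod_insert hi, Finset.sum_insert hi, ih, Bool.add_eq_xor]
      cases a (some i) <;> cases ∑ i ∈ s, a (some i) <;> simp
  rw [← key, rowSign]
  simp

theorem rowSign_eq_or (w : GadgetQubits N k → Bool) : rowSign w = 1 ∨ rowSign w = -1 := by
  refine Finset.prod_induction _ (fun x : ℂ => x = 1 ∨ x = -1) ?_ (Or.inl rfl) ?_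
  · rintro a b (rfl | rfl) (rfl | rfl) <;> simp
  · intro c _
    split_ifs <;> simp

/-- An operator of constant depth that computes the parity of `k` qubits into a target, with a register
of ancilla qubits. -/
theorem exists_gadget [NeZero k] (hN : N = (8 * k) ^ k) :
    ∃ A : Operator (GadgetQubits N k), Implements (fun _ => True) 27 A ∧
      ∀ a : Option (Fin k) → Bool, A *ᵥ ket (Sum.elim a fun _ => false) =
        ket (Sum.elim (Function.update a none (a none + ∑ i, a (some i))) fun _ => false) := by
  obtain ⟨A, hA, hA', hAu, hv0, hvk⟩ := exists_preparation hN
  have hE := implements_reflection_zero (N := N) (k := k)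
  have hK := implements_columnSign (N := N) (k := k)
  set o : Register N k → Bool := fun _ => false with ho
  set C := amplify o A columnSign with hCdef
  -- Three preparations, two reflections at zero and one column sign, each of depth one.
  have hC : Implements (fun _ => True) 6 C :=
    ((((hA.mul hE).mul hA').mul (hE.mul hK)).mul hA).congr_depth (by simp) |>.congr_depth rfl
  have hC' : Implements (fun _ => True) 6 Cᴴ := by
    have hEs : (reflection o)ᴴ = reflection o := by
      rw [reflection, diagonal_conjTranspose]
      congr 1
      funext y
      simp only [Pi.star_apply]
      split_ifs <;> simp
    have hKs : (diagonal (columnSign : (Register N k → Bool) → ℂ))ᴴ = diagonal columnSign := by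
      rw [diagonal_conjTranspose]
      congr 1
      funext y
      rcases columnSign_eq_or y with h | h <;> simp [h]
    rw [hCdef, amplify]
    simp only [conjTranspose_mul, hEs, hKs, conjTranspose_conjTranspose]
    exact (hA'.mul ((hK.mul hE).mul (hA.mul (hE.mul hA')))).congr_depth rfl
  let ρ := rightBlock (Option (Fin k)) (Register N k)
  set W := blockOp ρ Cᴴ * diagonal (rowSign : (GadgetQubits N k → Bool) → ℂ) * blockOp ρ C with hW
  have hWi : Implements (fun _ => True) 13 W :=
    (((hC'.blockOp ρ).mul implements_rowSign).mul (hC.blockOp ρ)).congr_depth rfl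
  -- The reflection test gives a sign when the target is set and the parity is even; the `Z` gate on
  -- the target changes even to odd. The depth is `27 = 13 + 1 + 13`, with `13 = 6 + 1 + 6` for `W`.
  set Φ := tensorUnitary (fun q : GadgetQubits N k => signGate (decide (q = Sum.inl none))) *
    (W * diagonal registerSign * W) with hΦ
  have hΦi : Implements (fun _ => True) 27 Φ :=
    (((hWi.mul implements_registerSign).mul hWi).tensor_mul _).congr_depth rfl
  let t : GadgetQubits N k → Bool := fun q => decide (q = Sum.inl none)
  refine ⟨hadamardOn t * Φ * hadamardOn t, ?_, fun a => ?_⟩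
  · rw [Matrix.mul_assoc]
    exact ((hΦi.mul (.tensor _)).tensor_mul _).congr_depth (by simp)
  have hΦa : ∀ a : Option (Fin k) → Bool, Φ *ᵥ ket (Sum.elim a o) =
      (if (∑ i, a (some i)) && a none then (-1 : ℂ) else 1) • ket (Sum.elim a o) := by
    intro a
    set δ : (Register N k → Bool) → ℂ := fun r => rowSign (Sum.elim a r) with hδ
    have hWint : Intertwines (Sum.elim a) W (Cᴴ * diagonal δ * C) :=
      ((intertwines_blockOp a _).mul (intertwines_diagonal a _)).mul (intertwines_blockOp a _)
    have hEint : Intertwines (Sum.elim a) (diagonal (registerSign : (GadgetQubits N k → Bool) → ℂ))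
        (if a none then reflection o else 1) := by
      convert intertwines_diagonal a (registerSign : (GadgetQubits N k → Bool) → ℂ) using 1
      cases h : a none
      · rw [if_neg (by simp), ← diagonal_one]
        simp [registerSign, h]
      · rw [if_pos rfl, reflection]
        simp [registerSign, h, ho, funext_iff]
    have hδk : ∀ y, columnSign y = -1 → δ y = 1 := by
      intro y hy
      obtain ⟨c, hc⟩ := exists_column_of_columnSign hy
      -- The all-one column `c` meets every row, so no row passes the zero test.
      refine Finset.prod_eq_one fun i _ => if_neg fun h => ?_
      have := h.2 c
      simp [hc] at this
    have key := signTest_mulVec_ket (o := o) hAu columnSign_eq_or columnSign_zero hv0 hvk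
      (δ := δ) (fun y => rowSign_eq_or _) hδk (!(∑ i, a (some i))) (a none) (rowSign_zero a)
    rw [hΦ, ← mulVec_mulVec, ← basisMap_mulVec_ket, ((hWint.mul hEint).mul hWint).mulVec, key,
      mulVec_smul, mulVec_smul, basisMap_mulVec_ket]
    ext x
    rw [Pi.smul_apply, Pi.smul_apply, tensorUnitary_mulVec_ket, ket_apply]
    by_cases hx : x = Sum.elim a o
    · subst hx
      rw [Finset.prod_eq_single (Sum.inl none)]
      · cases h : a none <;> cases h' : ∑ i, a (some i) <;> simp [signGate, h]
      · intro q _ hq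
        simp [hq, signGate_false]
      · simp
    · obtain ⟨q, hq⟩ := Function.ne_iff.1 hx
      rw [Finset.prod_eq_zero (Finset.mem_univ q)]
      · simp [hx]
      · simp [signGate, hq]
  rw [kickback t (fun q => decide (q = Sum.inl none) && ∑ i, a (some i)) (Sum.elim a o)
    (fun q hq => (Bool.and_eq_true_iff.1 hq).1)]
  · congr 1
    funext q
    cases q with
    | inl q =>
      cases q with
      | none => simp [Bool.add_eq_xor]
      | some i => simp
    | inr q => simp [ho]
  · intro w hw
    obtain ⟨b, rfl⟩ : ∃ b, w = Sum.elim (Function.update a none b) o := by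
      refine ⟨w (Sum.inl none), funext fun q => ?_⟩
      cases q with
      | inl q =>
        cases q with
        | none => simp
        | some i => rw [hw _ (by simp [t])]; simp
      | inr q => rw [hw _ (by simp [t])]; simp
    rw [hΦa]
    congr 1
    rw [Finset.prod_eq_single (Sum.inl none)]
    · simp
    · intro q _ hq
      simp [hq]
    · simp

end Gadget

/-! ### The tree of gadgets on a lattice -/

section Assembly

/-- Any numbering of the qubits places them in row `0`; with one routing row per qubit, every layer
is routable. The lattice size is quadratic in the number of qubits, which remains polynomial. -/
theorem exists_circuit2D_of_implements {Q : Type} [Fintype Q] [DecidableEq Q] [Nonempty Q] {n d : ℕ}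
    {A : Operator Q} (h : Implements (fun _ => True) d A) (e : Fin (n + 1) ↪ Q)
    (hA : ∀ z : Q → Bool, (∀ q, q ∉ Set.range e → z q = false) →
      A *ᵥ ket z = ket (Function.update z (e (Fin.last n))
        (z (e (Fin.last n)) + ∑ i : Fin n, z (e i.castSucc)))) :
    ∃ C : Circuit2D (Fintype.card Q + 1) (Fintype.card Q),
      C.depth = 3 * d ∧ C.Synthesizes (parityUnitary n) := by
  have : NeZero (Fintype.card Q) := ⟨Fintype.card_ne_zero⟩
  let E := Fintype.equivFin Q
  let ι : Unit × Q ↪ Fin (Fintype.card Q) :=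
    ⟨fun p => E p.2, fun _ _ h => Prod.ext rfl (E.injective h)⟩
  refine exists_circuit2D_of_routable (h.blockOp ι).isRoutable (e.trans E.toEmbedding)
    fun z hz => ?_
  rw [blockOp_mulVec_ket ι (f := fun _ => _) fun _ => hA (fun g => z (E g)) fun q hq => hz _ ?_]
  · congr 1
    symm
    refine eq_blockState (fun q hq => absurd (E.apply_symm_apply q) (hq ((), E.symm q)))
      fun _ g => ?_
    change Function.update z (E (e (Fin.last n))) _ (E g) = _
    by_cases hg : g = e (Fin.last n)
    · subst hg; simp
    · rw [Function.update_of_ne hg, Function.update_of_ne (E.injective.ne hg)]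
  · rintro ⟨i, hi⟩
    exact hq ⟨i, E.injective hi⟩

/-- The position of a data qubit of the gadget in its block. -/
def blockPosition {k : ℕ} : Option (Fin k) → ℕ
  | none => 0
  | some i => i + 1

theorem blockPosition_le {k : ℕ} (q : Option (Fin k)) : blockPosition q ≤ k := by
  cases q with
  | none => exact Nat.zero_le _
  | some i => exact i.isLt

theorem blockPosition_injective {k : ℕ} :
    Function.Injective (blockPosition : Option (Fin k) → ℕ) := by
  intro q q' h
  cases q <;> cases q' <;> simp [blockPosition, Fin.ext_iff] at h ⊢
  exact h

variable {N k L : ℕ}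

/-- The qubits of the tree of parity gadgets: each data qubit has its own register. -/
abbrev TreeQubits (N k L : ℕ) : Type := Fin ((k + 1) ^ L + 1) × Option (Register N k)

/-- The data qubits of the tree. -/
def treeData (N k L : ℕ) (i : ℕ) : TreeQubits N k L :=
  (⟨min i ((k + 1) ^ L), by omega⟩, none)

theorem treeData_inj : ∀ i ≤ (k + 1) ^ L, ∀ j ≤ (k + 1) ^ L,
    treeData N k L i = treeData N k L j → i = j := by
  intro i hi j hj h
  simp only [treeData, Prod.mk.injEq, Fin.mk.injEq, and_true] at h
  omega

/-- Each block uses its first bit as target and the register attached to that bit. Distinct blocks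
share no qubits, so all gadgets run in parallel and the depth does not depend on `M`. -/
theorem exists_treeBlocks [NeZero k] (hN : N = (8 * k) ^ k) (s M : ℕ) (hs : 1 ≤ s)
    (hM : (k + 1) * M * s ≤ (k + 1) ^ L) :
    ∃ A, Implements (fun _ => True) 27 A ∧ ∀ z : TreeQubits N k L → Bool,
      (∀ q, q.2 ≠ none → z q = false) → A *ᵥ ket z = ket (blockSum (treeData N k L) k s M z) := by
  obtain ⟨B, hB, hBz⟩ := exists_gadget hN
  set δ := treeData N k L with hδ
  have hlt : ∀ {p : ℕ} (q : Option (Fin k)), p < M →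
      ((k + 1) * p + blockPosition q) * s < (k + 1) ^ L :=
    fun q hp => block_index_lt hM hs hp (blockPosition_le q)
  have hinj : ∀ {p p' : ℕ} {q q' : Option (Fin k)}, p < M → p' < M →
      δ (((k + 1) * p + blockPosition q) * s) = δ (((k + 1) * p' + blockPosition q') * s) →
        p = p' ∧ q = q' := fun hp hp' h => by
    have := block_index_inj hs (blockPosition_le _) (blockPosition_le _)
      (treeData_inj _ (hlt _ hp).le _ (hlt _ hp').le h)
    exact ⟨this.1, blockPosition_injective this.2⟩
  let ι : Fin M × GadgetQubits N k ↪ TreeQubits N k L :=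
    ⟨fun x => x.2.elim (fun q => δ (((k + 1) * x.1 + blockPosition q) * s))
        fun r => ((δ (((k + 1) * x.1 + blockPosition none) * s)).1, some r), by
      rintro ⟨p, q | r⟩ ⟨p', q' | r'⟩ h
      · obtain ⟨h1, h2⟩ := hinj p.isLt p'.isLt h
        rw [Fin.ext h1, h2]
      · simp [hδ, treeData] at h
      · simp [hδ, treeData] at h
      · simp only [Sum.elim_inr, Prod.mk.injEq, Option.some.injEq] at h
        obtain ⟨h1, -⟩ := hinj p.isLt p'.isLt (Prod.ext h.1 rfl)
        rw [Fin.ext h1, h.2]⟩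
  have hιl : ∀ p q, ι (p, Sum.inl q) = δ (((k + 1) * p + blockPosition q) * s) := fun _ _ => rfl
  have hιr : ∀ p r, (ι (p, Sum.inr r)).2 ≠ none := fun _ _ => Option.some_ne_none _
  refine ⟨blockOp ι B, hB.blockOp ι, fun z hz => ?_⟩
  have hzι : ∀ p, (fun g => z (ι (p, g))) =
      Sum.elim (fun q => z (δ (((k + 1) * p + blockPosition q) * s))) fun _ => false := by
    intro p
    funext g
    cases g with
    | inl q => rfl
    | inr r => exact hz _ (hιr p r)
  rw [blockOp_mulVec_ket ι (f := fun p => _) fun p => (by rw [hzι p]; exact hBz _)]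
  congr 1
  symm
  refine eq_blockState (fun q hq => ?_) fun p g => ?_
  · rw [blockSum_of_ne]
    intro p hp h
    exact hq (⟨p, hp⟩, Sum.inl none) h.symm
  · cases g with
    | inl q =>
      cases q with
      | none =>
        rw [hιl, Sum.elim_inl, Function.update_self]
        exact (blockSum_head treeData_inj hs hM p.isLt z).trans
          (by rw [Finset.sum_range]; rfl)
      | some i =>
        rw [hιl, Sum.elim_inl, Function.update_of_ne (by simp)]
        exact blockSum_child treeData_inj hs hM p.isLt i.isLt z
    | inr r =>
      rw [Sum.elim_inr, blockSum_of_ne]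
      · exact hz _ (hιr p r)
      · intro p' _ h
        have := congrArg Prod.snd h
        exact hιr p r this

/-- Each level runs the gadgets of depth `27` twice, one `CNOT` reaches the target, and routing
triples the depth. -/
theorem exists_circuit2D_treeQubits [NeZero k] (hN : N = (8 * k) ^ k) (n : ℕ)
    (hn : n ≤ (k + 1) ^ L) :
    ∃ C : Circuit2D (Fintype.card (TreeQubits N k L) + 1) (Fintype.card (TreeQubits N k L)),
      C.depth = 3 * (54 * L + 1) ∧ C.Synthesizes (parityUnitary n) := by
  obtain ⟨A, hA, hAz⟩ := exists_tree (P := fun _ => True) (k := k) (L := L) (c := 27) (c₀ := 1)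
    (δ := treeData N k L) (anc := {q | q.2 ≠ none}) treeData_inj (fun _ _ h => h rfl)
    (exists_treeBlocks hN) (Implements.cnot (P := fun _ => True)
      (fun h => (pow_pos (Nat.succ_pos k) L).ne (treeData_inj _ (Nat.zero_le _) _ le_rfl h))
      trivial)
  refine exists_circuit2D_of_implements hA (treePlacement hn (treeData N k L) treeData_inj)
    fun z hz => ?_
  rw [hAz z, treePlacement_last, ← sum_treePlacement hn _ treeData_inj z hz]
  intro q hq
  refine hz q ?_
  rintro ⟨i, rfl⟩
  rw [treePlacement_apply] at hq
  split_ifs at hq <;> exact hq rfl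

theorem card_treeQubits : Fintype.card (TreeQubits N k L) = ((k + 1) ^ L + 1) * (N * k + 2) := by
  simp [Fintype.card_option]

end Assembly

/-! ### Bounds on depth and size -/

section Asymptotics

theorem clog_le_log_div_log_add_one {K n : ℕ} (hK : 2 ≤ K) (hn : 1 ≤ n) :
    (Nat.clog K n : ℝ) ≤ Real.log n / Real.log K + 1 := by
  have h0 : 0 ≤ Real.logb K n :=
    Real.logb_nonneg (by exact_mod_cast hK) (by exact_mod_cast hn)
  rw [← Real.natCeil_logb_natCast]
  exact (Nat.ceil_lt_add_one h0).le

/-- Rounding `n` up to a power of `K` costs at most a factor `K`. -/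
theorem pow_clog_le {K n : ℕ} (hK : 2 ≤ K) (hn : 2 ≤ n) : K ^ Nat.clog K n ≤ K * n := by
  have h := Nat.pow_pred_clog_lt_self (b := K) (x := n) (by omega) (by omega)
  have hpos := Nat.clog_pos (b := K) (n := n) (by omega) (by omega)
  calc K ^ Nat.clog K n = K * K ^ (Nat.clog K n).pred := by
        rw [← pow_succ', ← Nat.succ_eq_add_one, Nat.succ_pred_eq_of_pos hpos]
    _ ≤ K * n := Nat.mul_le_mul_left _ h.le

theorem isBigO_pow_of_le {f : ℕ → ℕ} {a c : ℕ} (h : ∀ n, 2 ≤ n → f n ≤ a * n ^ c) :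
    Asymptotics.IsBigO Filter.atTop (fun n => (f n : ℝ)) (fun n : ℕ => (n : ℝ) ^ c) := by
  refine Asymptotics.IsBigO.of_bound a ?_
  filter_upwards [Filter.eventually_ge_atTop 2] with n hn
  rw [Real.norm_of_nonneg (by positivity), Real.norm_of_nonneg (by positivity)]
  exact_mod_cast h n hn

theorem isBigO_log_clog :
    Asymptotics.IsBigO Filter.atTop (fun n : ℕ => ((3 * (2 * Nat.clog 2 n + 1) : ℕ) : ℝ))
      (fun n : ℕ => Real.log n) := by
  refine Asymptotics.IsBigO.of_bound (6 / Real.log 2 + 9) ?_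
  filter_upwards [Filter.eventually_ge_atTop 3] with n hn
  have hlog : 1 ≤ Real.log n := by
    rw [Real.le_log_iff_exp_le (by positivity)]
    exact Real.exp_one_lt_three.le.trans (by exact_mod_cast hn)
  have h := clog_le_log_div_log_add_one (K := 2) (n := n) le_rfl (by omega)
  rw [Real.norm_of_nonneg (by positivity), Real.norm_of_nonneg (by positivity)]
  push_cast at h ⊢
  calc 3 * (2 * (Nat.clog 2 n : ℝ) + 1) ≤ 3 * (2 * (Real.log n / Real.log 2 + 1) + 1) := by gcongr
    _ = 6 / Real.log 2 * Real.log n + 9 := by ring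
    _ ≤ (6 / Real.log 2 + 9) * Real.log n := by rw [add_mul]; linarith

/-- The block size of the tree, of order `√(log n)`. -/
def blockSize (n : ℕ) : ℕ := Nat.sqrt (Nat.log 2 n) + 1

/-- The base `blockSize n + 1` is at least about `√(log n)`, so its logarithm is at least half of
`log log n`: passing from `log n` to its square root costs only a factor two in the depth. -/
theorem log_log_le_blockSize {n : ℕ} (hn : 1 ≤ n) (hlog : 0 < Real.log n) :
    Real.log (Real.log n) ≤ 2 * Real.log ((blockSize n + 1 : ℕ) : ℝ) := by
  have h1 : Nat.log 2 n + 1 ≤ (blockSize n + 1) ^ 2 := by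
    have := Nat.lt_succ_sqrt (Nat.log 2 n)
    rw [blockSize]
    simp only [Nat.succ_eq_add_one] at this
    nlinarith
  have h2 : Real.log n ≤ ((Nat.log 2 n + 1 : ℕ) : ℝ) := by
    have h3 : (n : ℝ) ≤ 2 ^ (Nat.log 2 n + 1) := by
      exact_mod_cast (Nat.lt_pow_succ_log_self (b := 2) (by omega) n).le
    calc Real.log n ≤ Real.log (2 ^ (Nat.log 2 n + 1)) :=
          Real.log_le_log (by exact_mod_cast hn) h3
      _ = ((Nat.log 2 n + 1 : ℕ) : ℝ) * Real.log 2 := Real.log_pow _ _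
      _ ≤ ((Nat.log 2 n + 1 : ℕ) : ℝ) * 1 := by
          gcongr
          linarith [Real.log_two_lt_d9]
      _ = _ := mul_one _
  calc Real.log (Real.log n) ≤ Real.log (((blockSize n + 1 : ℕ) : ℝ) ^ 2) := by
        refine Real.log_le_log hlog (h2.trans ?_)
        exact_mod_cast h1
    _ = 2 * Real.log ((blockSize n + 1 : ℕ) : ℝ) := by rw [Real.log_pow]; norm_num

theorem isBigO_log_div_log_log_clog :
    Asymptotics.IsBigO Filter.atTop
      (fun n : ℕ => ((3 * (54 * Nat.clog (blockSize n + 1) n + 1) : ℕ) : ℝ))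
      (fun n : ℕ => Real.log n / Real.log (Real.log n)) := by
  -- With `x = log n / log log n ≥ 1`, the depth is at most `3 * (54 * (2 * x + 1) + 1) = 324 * x +
  -- 165 ≤ 489 * x`.
  refine Asymptotics.IsBigO.of_bound 489 ?_
  have hlog1 : ∀ᶠ n : ℕ in Filter.atTop, 1 < Real.log n :=
    (Real.tendsto_log_atTop.comp tendsto_natCast_atTop_atTop).eventually_gt_atTop 1
  filter_upwards [Filter.eventually_ge_atTop 3, hlog1] with n hn hlog
  have hll : 0 < Real.log (Real.log n) := Real.log_pos hlog
  have hle : Real.log (Real.log n) ≤ Real.log n := by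
    linarith [Real.log_le_sub_one_of_pos (by linarith : 0 < Real.log n)]
  have hK := log_log_le_blockSize (n := n) (by omega) (by linarith)
  set K := blockSize n + 1 with hKdef
  have hK2 : 2 ≤ K := by simp [hKdef, blockSize]
  have h := clog_le_log_div_log_add_one (K := K) (n := n) hK2 (by omega)
  rw [Real.norm_of_nonneg (by positivity), Real.norm_of_nonneg (by positivity)]
  have hone : 1 ≤ Real.log n / Real.log (Real.log n) := by
    rwa [one_le_div hll]
  have hdiv : Real.log n / Real.log K ≤ 2 * (Real.log n / Real.log (Real.log n)) := by
    calc Real.log n / Real.log K ≤ Real.log n / (Real.log (Real.log n) / 2) := by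
          gcongr
          linarith
      _ = 2 * (Real.log n / Real.log (Real.log n)) := by field_simp
  push_cast
  linarith

/-- With block size `k`, the register has `(8 * k) ^ k ≤ 2 ^ (4 * k ^ 2)` columns. This is
polynomial in `n` because `k ^ 2` is of order `log n`, which is the reason for the square root in
`blockSize`. -/
theorem registerSize_le {n : ℕ} (hn : 2 ≤ n) :
    (8 * blockSize n) ^ blockSize n ≤ n ^ 16 := by
  have hl : 1 ≤ Nat.log 2 n := Nat.log_pos (by omega) hn
  have hs : 1 ≤ Nat.sqrt (Nat.log 2 n) := by
    rw [Nat.le_sqrt]; simpa using hl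
  have hs2 := Nat.sqrt_le' (Nat.log 2 n)
  have hk : blockSize n ^ 2 ≤ 4 * Nat.log 2 n := by
    rw [blockSize]
    nlinarith
  have h8 : 8 * blockSize n ≤ 2 ^ (4 * blockSize n) := by
    have h1 : blockSize n < 2 ^ blockSize n := Nat.lt_two_pow_self
    have h2 : 1 ≤ blockSize n := by simp [blockSize]
    calc 8 * blockSize n ≤ 2 ^ 3 * 2 ^ blockSize n := Nat.mul_le_mul_left _ h1.le
      _ = 2 ^ (3 + blockSize n) := by rw [pow_add]
      _ ≤ 2 ^ (4 * blockSize n) := Nat.pow_le_pow_right (by omega) (by omega)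
  calc (8 * blockSize n) ^ blockSize n ≤ (2 ^ (4 * blockSize n)) ^ blockSize n :=
        Nat.pow_le_pow_left h8 _
    _ = 2 ^ (4 * blockSize n ^ 2) := by rw [← pow_mul]; ring_nf
    _ ≤ 2 ^ (Nat.log 2 n * 16) := Nat.pow_le_pow_right (by omega) (by omega)
    _ = (2 ^ Nat.log 2 n) ^ 16 := pow_mul _ _ _
    _ ≤ n ^ 16 := Nat.pow_le_pow_left (Nat.pow_log_le_self 2 (by omega)) _

theorem card_treeQubits_le {n : ℕ} (hn : 2 ≤ n) :
    Fintype.card (TreeQubits ((8 * blockSize n) ^ blockSize n) (blockSize n)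
      (Nat.clog (blockSize n + 1) n)) ≤ 9 * n ^ 19 := by
  have hk : blockSize n ≤ n := by
    have h1 := Nat.sqrt_le_self (Nat.log 2 n)
    have h2 : Nat.log 2 n < n := Nat.log_lt_self 2 (by omega)
    rw [blockSize]
    omega
  have hK : 2 ≤ blockSize n + 1 := by simp [blockSize]
  have hpow : (blockSize n + 1) ^ Nat.clog (blockSize n + 1) n ≤ 2 * n ^ 2 := by
    refine (pow_clog_le hK hn).trans ?_
    nlinarith
  have h1 : 1 ≤ n ^ 2 := Nat.one_le_pow _ _ (by omega)
  have h2 : 1 ≤ n ^ 17 := Nat.one_le_pow _ _ (by omega)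
  rw [card_treeQubits]
  calc _ ≤ (2 * n ^ 2 + 1) * (n ^ 16 * n + 2) := by
        refine Nat.mul_le_mul (Nat.add_le_add_right hpow 1) (Nat.add_le_add_right ?_ 2)
        exact Nat.mul_le_mul (registerSize_le hn) hk
    _ ≤ (3 * n ^ 2) * (3 * n ^ 17) := by
        refine Nat.mul_le_mul (by omega) ?_
        rw [← pow_succ, show 16 + 1 = 17 from rfl]
        omega
    _ = 9 * n ^ 19 := by ring

end Asymptotics

end QAC

theorem mainTheorem10 :
    (∀ n : ℕ, 1 ≤ n →
      ∃ C : QAC.Circuit1D (n + 1),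
        C.depth = n ∧ C.Synthesizes (QAC.parityUnitary n)) ∧
    (∃ (d m : ℕ → ℕ) (c : ℕ),
      Asymptotics.IsBigO Filter.atTop (fun n => (d n : ℝ)) (fun n : ℕ => Real.log n) ∧
      Asymptotics.IsBigO Filter.atTop (fun n => (m n : ℝ)) (fun n : ℕ => (n : ℝ) ^ c) ∧
      ∀ n : ℕ, 1 ≤ n →
        ∃ C : QAC.Circuit2D 2 (m n),
          C.depth = d n ∧ C.Synthesizes (QAC.parityUnitary n)) ∧
    (∃ (d w m : ℕ → ℕ) (c : ℕ),
      Asymptotics.IsBigO Filter.atTop (fun n => (d n : ℝ))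
        (fun n : ℕ => Real.log n / Real.log (Real.log n)) ∧
      Asymptotics.IsBigO Filter.atTop (fun n => (w n : ℝ)) (fun n : ℕ => (n : ℝ) ^ c) ∧
      Asymptotics.IsBigO Filter.atTop (fun n => (m n : ℝ)) (fun n : ℕ => (n : ℝ) ^ c) ∧
      ∀ n : ℕ, 1 ≤ n →
        ∃ C : QAC.Circuit2D (w n) (m n),
          C.depth = d n ∧ C.Synthesizes (QAC.parityUnitary n)) := by
  refine ⟨QAC.exists_circuit1D, ⟨fun n => 3 * (2 * Nat.clog 2 n + 1), fun n => 2 ^ Nat.clog 2 n + 1,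
    1, QAC.isBigO_log_clog, QAC.isBigO_pow_of_le (a := 3) fun n hn => ?_, fun n _ =>
      QAC.exists_circuit2D_width_two n _ (Nat.le_pow_clog (by omega) n)⟩, ?_⟩
  -- The length is `2 ^ Nat.clog 2 n + 1 ≤ 2 * n + 1 ≤ 3 * n`.
  · have := QAC.pow_clog_le (K := 2) le_rfl hn
    rw [pow_one]
    omega
  · let card : ℕ → ℕ := fun n => Fintype.card (QAC.TreeQubits
      ((8 * QAC.blockSize n) ^ QAC.blockSize n) (QAC.blockSize n)
      (Nat.clog (QAC.blockSize n + 1) n))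
    refine ⟨fun n => 3 * (54 * Nat.clog (QAC.blockSize n + 1) n + 1), fun n => card n + 1, card, 19,
      QAC.isBigO_log_div_log_log_clog, QAC.isBigO_pow_of_le (a := 10) fun n hn => ?_,
      QAC.isBigO_pow_of_le (a := 9) fun n hn => QAC.card_treeQubits_le hn, fun n _ => ?_⟩
    · have h1 := QAC.card_treeQubits_le hn
      have h2 : 1 ≤ n ^ 19 := Nat.one_le_pow _ _ (by omega)
      simp only [card]
      omega
    · have : NeZero (QAC.blockSize n) := ⟨Nat.succ_ne_zero _⟩
      exact QAC.exists_circuit2D_treeQubits rfl n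
        (Nat.le_pow_clog (by simp [QAC.blockSize]) n)
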